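/- Call a monic polynomial $f(x)\in\mathbb{Z}[x]$ monogenic if $f$ is irreducible over $\mathbb{Q}$ and, for every root $\theta\in\mathbb{C}$ of $f$, the set $\{1,\theta,\dots,\theta^{\deg f-1}\}$ is a $\mathbb{Z}$-basis of the ring of integers of $\mathbb{Q}(\theta)$. Let $N\ge 6$ be an integer with $N\equiv 2\pmod 4$, and for every integer $b\ge 1$ define \[ f_{N,b}(x)=x^N-N(N-1)^b\,x-(N-1),\qquad \delta_{N,b}=(N-1)^{bN}+1 . \] 1. For every $b\ge 1$ such that $f_{N,b}$ is irreducible over $\mathbb{Q}$, the trinomial $f_{N,b}$ is monogenic if and only if both $N(N-1)$ and $\delta_{N,b}$ are squarefree. 2. If $b\ge 1$ and $f_{N,b}$ is monogenic, then every root of $f_{N,b}$ in $\mathbb{C}$ generates an extension of $\mathbb{Q}$ of degree $N$. No two of the monogenic trinomials generate the same extension: if $b_1\neq b_2$ are positive integers such that $f_{N,b_1}$ and $f_{N,b_2}$ are both monogenic, and $f_{N,b_1}(\alpha_1)=f_{N,b_2}(\alpha_2)=0$ with $\alpha_1,\alpha_2\in\mathbb{C}$, then the fields $\mathbb{Q}(\alpha_1)$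 and $\mathbb{Q}(\alpha_2)$ are not isomorphic (in particular, they are distinct). 3. If $b\ge 1$ and $f_{N,b}$ is monogenic, then $\mathbb{Q}(\sqrt{\delta_{N,b}})$ is a real quadratic field, and the integer $bN/2$ divides its class number. -/

import Mathlib

open Polynomial
open scoped IntermediateField NumberField

/-- A polynomial `f ∈ ℤ[x]` is *monogenic* if it is monic, irreducible over `ℚ`, and for every
root `θ ∈ ℂ` of `f` the powers `1, θ, …, θ ^ (deg f - 1)` form a `ℤ`-basis of the ring of integers
of `ℚ(θ)`. -/
def IsMonogenic (f : ℤ[X]) : Prop :=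
  f.Monic ∧ Irreducible (f.map (Int.castRingHom ℚ)) ∧
    ∀ θ : ℂ, aeval θ f = 0 →
      ∃ B : Module.Basis (Fin f.natDegree) ℤ (𝓞 ℚ⟮θ⟯),
        ∀ i : Fin f.natDegree, (((B i : 𝓞 ℚ⟮θ⟯) : ℚ⟮θ⟯) : ℂ) = θ ^ (i : ℕ)

/-- The trinomial `x ^ N - N (N - 1) ^ b x - (N - 1)` with integer coefficients. -/
noncomputable def jonesTrinomial (N b : ℕ) : ℤ[X] :=
  X ^ N - C ((N : ℤ) * ((N : ℤ) - 1) ^ b) * X - C ((N : ℤ) - 1)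

/-- The integer `(N - 1) ^ (b N) + 1`. -/
def delta (N b : ℕ) : ℤ := ((N : ℤ) - 1) ^ (b * N) + 1

/-- The subfield `ℚ(√d)` of `ℝ` (for `d ≥ 0`). -/
noncomputable abbrev realQuadraticField (d : ℤ) : IntermediateField ℚ ℝ :=
  ℚ⟮Real.sqrt (d : ℝ)⟯

theorem isIntegral_sqrt_intCast (d : ℤ) : IsIntegral ℚ (Real.sqrt (d : ℝ)) := by
  rcases le_total 0 d with h | h
  · refine IsIntegral.of_pow (n := 2) two_pos ?_
    rw [Real.sq_sqrt (by exact_mod_cast h)]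
    simpa using (isIntegral_algebraMap (R := ℚ) (A := ℝ) (x := (d : ℚ)))
  · rw [Real.sqrt_eq_zero_of_nonpos (by exact_mod_cast h)]
    exact isIntegral_zero

instance instNumberFieldRealQuadraticField (d : ℤ) : NumberField (realQuadraticField d) where
  to_charZero := inferInstance
  to_finiteDimensional :=
    IntermediateField.adjoin.finiteDimensional (isIntegral_sqrt_intCast d)

/-! Write `c = N - 1`, `s = c^b X + 1` and `δ = c^(bN) + 1`. Everything about `f` comes from two
identities: `X f' = N f + N c s`, and `c^(bN) f = s² G - N δ s + δ`, the expansion of `f` at the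
rational point `-c^(-b)`.

If `N c` and `δ` are squarefree, Uchida's criterion reduces monogenicity to `f ∉ M²` for maximal
ideals `M` of `ℤ[X]`. Membership would give `N c s ∈ M`, so `M` contains `N`, `c` or `s`; expanding
`f` in powers of a suitable `T ∈ M` then puts the integer `N`, `c` or `δ` itself into `M²`,
impossible for a squarefree integer. Conversely, if `p²` divides one of these integers, the same
expansions read `T² G + p T U + p² V ≡ 0` modulo `f`; then `T(θ) G(θ) / p` is an algebraic integer
outside `ℤ[θ]`.

For monogenic `f` the field discriminant is that of `f`, of absolute value `N^N c^(N-1) δ`. It is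
strictly increasing in `b`, so different `b` give non-isomorphic fields.

For the class number, put `t = c^(bN/2)`, so that `δ = t² + 1` and `ℤ[√δ]` is the maximal order. The
ideal `(1 + √δ)` has norm `c^(bN)` and is coprime to its conjugate, hence is a `bN`-th power. Were
the root of smaller order in the class group, some `z` that is not a unit, of norm at most `t` in
absolute value, would have a power associated to `1 + √δ`. Descent by the unit `t + √δ` makes such a
`z` an integer up to units, but `1 + √δ` has no integer divisor except `±1`. So the order is exactly
`bN`, a multiple of `bN/2`. -/

/-! ### Uchida's criterion for `ℤ[X] / (f)`. -/

/-- A nonzero prime ideal generated by two elements, one of which is a multiple of the other up to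
elements outside the prime, localizes to a discrete valuation ring. -/
theorem isDiscreteValuationRing_localization_of_span_pair {R : Type*} [CommRing R] [IsDomain R]
    [IsNoetherianRing R] {P : Ideal R} [P.IsPrime] (hP : P ≠ ⊥) {x y a b : R}
    (hspan : P = Ideal.span {x, y}) (hab : a * x + b * y = 0) (hn : a ∉ P) :
    IsDiscreteValuationRing (Localization.AtPrime P) := by
  have hloc : ¬ IsField (Localization.AtPrime P) := IsLocalization.AtPrime.not_isField R hP _
  have : IsNoetherianRing (Localization.AtPrime P) :=
    IsLocalization.isNoetherianRing P.primeCompl _ inferInstance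
  refine ((IsDiscreteValuationRing.TFAE (Localization.AtPrime P) hloc).out 0 4).mpr ?_
  refine ⟨algebraMap R _ y, ?_⟩
  have hmap := congrArg (Ideal.map (algebraMap R (Localization.AtPrime P))) hspan
  rw [Ideal.map_span, Set.image_pair] at hmap
  rw [← Localization.AtPrime.map_eq_maximalIdeal, hmap]
  refine le_antisymm (Ideal.span_le.2 ?_) (Ideal.span_mono (by simp))
  rintro z (rfl | rfl)
  · have hu : IsUnit (algebraMap R (Localization.AtPrime P) a) :=
      IsLocalization.map_units _ (⟨a, hn⟩ : P.primeCompl)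
    have h := congrArg (algebraMap R (Localization.AtPrime P)) hab
    simp only [map_add, map_mul, map_zero] at h
    refine Ideal.mem_span_singleton.2 ((hu.dvd_mul_left).1 ⟨-algebraMap R _ b, ?_⟩)
    linear_combination h
  · exact Ideal.subset_span rfl

/-- An ideal of `ℤ[X]` containing a prime number `p` is generated by `p` and one polynomial. -/
theorem exists_eq_span_natCast_pair (p : ℕ) [Fact p.Prime] (M : Ideal ℤ[X])
    (hp : (p : ℤ[X]) ∈ M) : ∃ φ : ℤ[X], M = Ideal.span {(p : ℤ[X]), φ} := by
  set π : ℤ[X] →+* (ZMod p)[X] := mapRingHom (Int.castRingHom (ZMod p))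
  have hπ : Function.Surjective π :=
    map_surjective _ (ZMod.ringHom_surjective (Int.castRingHom (ZMod p)))
  obtain ⟨φ', hφ'⟩ := (IsPrincipalIdealRing.principal (M.map π)).principal
  obtain ⟨φ, rfl⟩ := hπ φ'
  have hker : ∀ g : ℤ[X], π g = 0 → (p : ℤ[X]) ∣ g := by
    intro g hg
    have : (C (p : ℤ)) ∣ g := by
      rw [C_dvd_iff_dvd_coeff]
      intro i
      have := congrArg (fun h => coeff h i) hg
      simpa [π, ZMod.intCast_zmod_eq_zero_iff_dvd] using this
    simpa using this
  have hkerM : ∀ g : ℤ[X], π g = 0 → g ∈ M := fun g hg => by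
    obtain ⟨q, rfl⟩ := hker g hg
    exact M.mul_mem_right _ hp
  have hφM : φ ∈ M := by
    have : π φ ∈ M.map π := by rw [hφ']; exact Submodule.mem_span_singleton_self _
    obtain ⟨g, hg, hgφ⟩ := (Ideal.mem_map_iff_of_surjective π hπ).1 this
    have := hkerM (φ - g) (by rw [map_sub, hgφ, sub_self])
    simpa using M.add_mem this hg
  refine ⟨φ, le_antisymm (fun g hg => ?_) (Ideal.span_le.2 ?_)⟩
  · have : π g ∈ M.map π := Ideal.mem_map_of_mem π hg
    rw [hφ'] at this
    obtain ⟨q', hq⟩ := Ideal.mem_span_singleton.1 this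
    obtain ⟨q, rfl⟩ := hπ q'
    obtain ⟨r, hr⟩ := hker (g - φ * q) (by rw [map_sub, map_mul, hq, sub_self])
    exact Ideal.mem_span_pair.2 ⟨r, q, by linear_combination -hr⟩
  · rintro z (rfl | rfl)
    exacts [hp, hφM]

theorem natCast_dvd_of_dvd_mul_of_not_dvd {p : ℕ} [Fact p.Prime] {g h : ℤ[X]}
    (hg : ¬ (p : ℤ[X]) ∣ g) (hd : (p : ℤ[X]) ∣ g * h) : (p : ℤ[X]) ∣ h := by
  have : Prime (p : ℤ[X]) := by
    have := Polynomial.prime_C_iff.2 (Nat.prime_iff_prime_int.1 (Fact.out : p.Prime))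
    simpa using this
  exact (this.dvd_or_dvd hd).resolve_left hg

/-- A prime number contained in a prime ideal of `ℤ[X]` is not in the square of the ideal. -/
theorem natCast_notMem_sq (p : ℕ) [Fact p.Prime] (M : Ideal ℤ[X]) (hM : M ≠ ⊤)
    (hp : (p : ℤ[X]) ∈ M) : (p : ℤ[X]) ∉ M ^ 2 := by
  intro h2
  have hp0 : (p : ℤ[X]) ≠ 0 := Nat.cast_ne_zero.2 (Fact.out : p.Prime).ne_zero
  obtain ⟨φ, hφ⟩ := exists_eq_span_natCast_pair p M hp
  have hφM : φ ∈ M := by rw [hφ]; exact Ideal.subset_span (by simp)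
  have key : ∃ a b d : ℤ[X], (p : ℤ[X]) = p ^ 2 * a + p * φ * b + φ ^ 2 * d := by
    rw [hφ, pow_two, Ideal.span_mul_span'] at h2
    refine Submodule.span_induction (p := fun z _ => ∃ a b d : ℤ[X],
      z = p ^ 2 * a + p * φ * b + φ ^ 2 * d) ?_ ⟨0, 0, 0, by simp⟩ ?_ ?_ h2
    · rintro z ⟨u, (rfl | rfl), v, (rfl | rfl), rfl⟩
      · exact ⟨1, 0, 0, by ring⟩
      · exact ⟨0, 1, 0, by ring⟩
      · exact ⟨0, 1, 0, by ring⟩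
      · exact ⟨0, 0, 1, by ring⟩
    · rintro x y _ _ ⟨a, b, d, rfl⟩ ⟨a', b', d', rfl⟩
      exact ⟨a + a', b + b', d + d', by ring⟩
    · rintro r x _ ⟨a, b, d, rfl⟩
      exact ⟨r * a, r * b, r * d, by simp only [smul_eq_mul]; ring⟩
  obtain ⟨a, b, d, h⟩ := key
  -- One factor `p` cancels from the relation in either case: `p` divides `φ`, or, being prime in
  -- `ℤ[X]`, it divides `d`. What remains expresses `1` through `p` and `φ`.
  have hone : (1 : ℤ[X]) ∈ M := by
    by_cases hpφ : (p : ℤ[X]) ∣ φ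
    · obtain ⟨ψ, hψ⟩ := hpφ
      have : (1 : ℤ[X]) = p * (a + ψ * b + ψ ^ 2 * d) := by
        apply mul_left_cancel₀ hp0
        rw [hψ] at h
        linear_combination h
      rw [this]
      exact M.mul_mem_right _ hp
    · have hd : (p : ℤ[X]) ∣ φ * (φ * d) := ⟨1 - p * a - φ * b, by linear_combination -h⟩
      obtain ⟨d', rfl⟩ := natCast_dvd_of_dvd_mul_of_not_dvd hpφ
        (natCast_dvd_of_dvd_mul_of_not_dvd hpφ hd)
      have : (1 : ℤ[X]) = p * a + φ * (b + φ * d') := by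
        apply mul_left_cancel₀ hp0
        linear_combination h
      rw [this]
      exact M.add_mem (M.mul_mem_right _ hp) (M.mul_mem_right _ hφM)
  exact hM ((Ideal.eq_top_iff_one M).2 hone)

/-- Uchida's criterion: if `f ∈ ℤ[X]` is monic and irreducible and lies in the square of no
maximal ideal of `ℤ[X]` that contains a prime number, then `ℤ[X] / (f)` is integrally closed. -/
theorem isIntegrallyClosed_adjoinRoot {f : ℤ[X]} (hf : f.Monic) (hirr : Irreducible f)
    (h : ∀ (p : ℕ) (M : Ideal ℤ[X]), p.Prime → M.IsMaximal → (p : ℤ[X]) ∈ M → f ∉ M ^ 2) :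
    IsIntegrallyClosed (AdjoinRoot f) := by
  have : IsDomain (AdjoinRoot f) := AdjoinRoot.isDomain_of_prime hirr.prime
  have : Module.Free ℤ (AdjoinRoot f) := hf.free_adjoinRoot
  have : Module.Finite ℤ (AdjoinRoot f) := hf.finite_adjoinRoot
  have : IsNoetherianRing (AdjoinRoot f) :=
    isNoetherianRing_of_surjective ℤ[X] _ (AdjoinRoot.mk f) AdjoinRoot.mk_surjective
  have hdvr : IsDedekindDomainDvr (AdjoinRoot f) := by
    refine { is_dvr_at_nonzero_prime := ?_ }
    intro P hP hPp
    have hne : P.comap (algebraMap ℤ (AdjoinRoot f)) ≠ ⊥ := by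
      obtain ⟨x, hx, hx0⟩ := Submodule.exists_mem_ne_zero_of_ne_bot hP
      exact Ideal.comap_ne_bot_of_integral_mem hx0 hx (Algebra.IsIntegral.isIntegral x)
    obtain ⟨q, hq⟩ :=
      (IsPrincipalIdealRing.principal (P.comap (algebraMap ℤ (AdjoinRoot f)))).principal
    have hqprime : Prime q := by
      have hpr : (P.comap (algebraMap ℤ (AdjoinRoot f))).IsPrime := inferInstance
      rw [hq] at hpr hne
      exact (Ideal.span_singleton_prime (by rintro rfl; simp at hne)).1 hpr
    have hp : q.natAbs.Prime := Int.prime_iff_natAbs_prime.1 hqprime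
    have := Fact.mk hp
    set p := q.natAbs
    set M : Ideal ℤ[X] := P.comap (AdjoinRoot.mk f)
    have hpM : (p : ℤ[X]) ∈ M := by
      have : (p : ℤ) ∈ P.comap (algebraMap ℤ (AdjoinRoot f)) := by
        rw [hq]
        exact Ideal.mem_span_singleton.2 (Int.dvd_natAbs.2 dvd_rfl)
      simpa [M] using this
    obtain ⟨φ, hφ⟩ := exists_eq_span_natCast_pair p M hpM
    have hφM : φ ∈ M := by rw [hφ]; exact Ideal.subset_span (by simp)
    have hPspan : P = Ideal.span {AdjoinRoot.mk f p, AdjoinRoot.mk f φ} := by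
      rw [← Ideal.map_comap_of_surjective _ AdjoinRoot.mk_surjective P]
      change M.map _ = _
      rw [hφ, Ideal.map_span, Set.image_pair]
    have hfM : f ∈ M := by simp [M]
    have hmax : M.IsMaximal := by
      have : (P.comap (algebraMap ℤ (AdjoinRoot f))).IsMaximal :=
        Ideal.IsPrime.isMaximal inferInstance hne
      have : P.IsMaximal := Ideal.isMaximal_of_isIntegral_of_isMaximal_comap P this
      exact Ideal.comap_isMaximal_of_surjective _ AdjoinRoot.mk_surjective
    -- Since `f = A p + B φ` is not in `M²`, one of `A`, `B` lies outside `M`. Modulo `f` the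
    -- relation `A p + B φ = 0` then makes one generator of `P` locally redundant.
    obtain ⟨A, B, hAB⟩ := Ideal.mem_span_pair.1 (hφ ▸ hfM)
    have hrel := congrArg (AdjoinRoot.mk f) hAB
    rw [AdjoinRoot.mk_self, map_add, map_mul, map_mul] at hrel
    by_cases hA : A ∈ M
    · have hB : B ∉ M := fun hB => h p M hp hmax hpM (by
        rw [← hAB, pow_two]
        exact Ideal.add_mem _ (Ideal.mul_mem_mul hA hpM) (Ideal.mul_mem_mul hB hφM))
      rw [Set.pair_comm] at hPspan
      exact isDiscreteValuationRing_localization_of_span_pair hP hPspan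
        ((add_comm _ _).trans hrel) hB
    · exact isDiscreteValuationRing_localization_of_span_pair hP hPspan hrel hA
  infer_instance

/-! ### From integral closedness to an integral power basis. -/

theorem dvd_of_aeval_eq_zero {f : ℤ[X]} (hf : f.Monic)
    (hirr : Irreducible (f.map (Int.castRingHom ℚ))) {K : Type*} [Field K] [CharZero K] {θ : K}
    (hθ : aeval θ f = 0) {g : ℤ[X]} (hg : aeval θ g = 0) : f ∣ g := by
  have hmap : ∀ h : ℤ[X], aeval θ h = 0 → aeval θ (h.map (Int.castRingHom ℚ)) = 0 :=
    fun h hh => (aeval_map_algebraMap ℚ θ h).trans hh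
  have hmin : f.map (Int.castRingHom ℚ) = minpoly ℚ θ :=
    minpoly.eq_of_irreducible_of_monic hirr (hmap f hθ) (hf.map _)
  refine (map_dvd_map (Int.castRingHom ℚ) (Int.cast_injective) hf).1 ?_
  rw [hmin]
  exact minpoly.dvd ℚ θ (hmap g hg)

theorem exists_aeval_intCast_eq {K : Type*} [Field K] [CharZero K] (θ : K) (g : ℚ[X]) :
    ∃ (n : ℤ) (h : ℤ[X]), n ≠ 0 ∧ (n : K) * aeval θ g = aeval θ h := by
  obtain ⟨n, hn, hb⟩ := IsLocalization.integerNormalization_spec (nonZeroDivisors ℤ) g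
  refine ⟨n, IsLocalization.integerNormalization (nonZeroDivisors ℤ) g,
    nonZeroDivisors.ne_zero hn, ?_⟩
  rw [← aeval_map_algebraMap ℚ θ (IsLocalization.integerNormalization _ g), hb]
  simp

/-- A monic irreducible `f` for which `ℤ[X] / (f)` is integrally closed is monogenic. -/
theorem isMonogenic_of_isIntegrallyClosed {f : ℤ[X]} (hf : f.Monic)
    (hirr : Irreducible (f.map (Int.castRingHom ℚ))) (hcl : IsIntegrallyClosed (AdjoinRoot f)) :
    IsMonogenic f := by
  refine ⟨hf, hirr, fun θ hθ => ?_⟩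
  have hirrZ : Irreducible f := (hf.irreducible_iff_irreducible_map_fraction_map (K := ℚ)).2 hirr
  have : IsDomain (AdjoinRoot f) := AdjoinRoot.isDomain_of_prime hirrZ.prime
  have : Module.Finite ℤ (AdjoinRoot f) := hf.finite_adjoinRoot
  have hint : IsIntegral ℤ θ := ⟨f, hf, hθ⟩
  set θ' : ℚ⟮θ⟯ := IntermediateField.AdjoinSimple.gen ℚ θ
  have hθ' : aeval θ' f = 0 := by
    have : algebraMap ℚ⟮θ⟯ ℂ (aeval θ' f) = 0 := by
      rw [← aeval_algebraMap_apply]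
      exact hθ
    exact (map_eq_zero_iff _ (algebraMap ℚ⟮θ⟯ ℂ).injective).1 this
  let e : AdjoinRoot f →ₐ[ℤ] ℚ⟮θ⟯ := AdjoinRoot.liftAlgHom f (Algebra.ofId ℤ _) θ' hθ'
  have he : ∀ g : ℤ[X], e (AdjoinRoot.mk f g) = aeval θ' g := fun g =>
    AdjoinRoot.liftAlgHom_mk ..
  have hinj : Function.Injective e := (injective_iff_map_eq_zero e).2 fun x hx => by
    obtain ⟨g, rfl⟩ := AdjoinRoot.mk_surjective x
    exact AdjoinRoot.mk_eq_zero.2 (dvd_of_aeval_eq_zero hf hirr hθ' ((he g).symm.trans hx))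
  let _ : Algebra (AdjoinRoot f) ℚ⟮θ⟯ := e.toRingHom.toAlgebra
  have : FaithfulSMul (AdjoinRoot f) ℚ⟮θ⟯ :=
    (faithfulSMul_iff_algebraMap_injective _ _).2 hinj
  have : IsScalarTower ℤ (AdjoinRoot f) ℚ⟮θ⟯ := .of_algebraMap_eq fun n => (e.commutes n).symm
  have : IsFractionRing (AdjoinRoot f) ℚ⟮θ⟯ := by
    refine IsFractionRing.of_field _ _ fun z => ?_
    obtain ⟨g, rfl⟩ : ∃ g : ℚ[X], aeval θ' g = z := by
      obtain ⟨g, hg⟩ := (IntermediateField.adjoin.powerBasis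
        (hint.tower_top (A := ℚ))).exists_eq_aeval' z
      exact ⟨g, hg.symm⟩
    obtain ⟨n, h, hn, hnh⟩ := exists_aeval_intCast_eq θ' g
    refine ⟨AdjoinRoot.mk f h, n, ?_⟩
    rw [map_intCast, eq_div_iff (Int.cast_ne_zero.2 hn), mul_comm, hnh]
    exact (he h).symm
  let e' : AdjoinRoot f →ₗ[ℤ] 𝓞 ℚ⟮θ⟯ :=
    { toFun := fun x => ⟨e x, (Algebra.IsIntegral.isIntegral (R := ℤ) x).map e⟩
      map_add' := fun x y => Subtype.ext (map_add e x y)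
      map_smul' := fun n x => Subtype.ext (map_smul e n x) }
  -- Surjectivity is where integral closedness enters: `ℚ(θ)` is the fraction field of `ℤ[X] / (f)`.
  have hbij : Function.Bijective e' := by
    refine ⟨fun x y hxy => hinj (congrArg Subtype.val hxy), fun y => ?_⟩
    obtain ⟨x, hx⟩ := IsIntegrallyClosed.isIntegral_iff.1
      ((NumberField.RingOfIntegers.isIntegral_coe y).tower_top (A := AdjoinRoot f))
    exact ⟨x, Subtype.ext hx⟩
  let B : Module.Basis (Fin f.natDegree) ℤ (AdjoinRoot f) :=
    (AdjoinRoot.powerBasis' hf).basis.reindex (finCongr (AdjoinRoot.powerBasis'_dim hf))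
  refine ⟨B.map (LinearEquiv.ofBijective e' hbij), fun i => ?_⟩
  have h1 : B i = AdjoinRoot.mk f (X ^ (i : ℕ)) := by
    simp [B, PowerBasis.coe_basis]
  have h2 : e (AdjoinRoot.mk f (X ^ (i : ℕ))) = θ' ^ (i : ℕ) := by rw [he]; simp
  have h3 : ((θ' : ℚ⟮θ⟯) : ℂ) = θ := IntermediateField.AdjoinSimple.coe_gen ℚ θ
  rw [Module.Basis.map_apply, h1]
  change ((e (AdjoinRoot.mk f (X ^ (i : ℕ))) : ℚ⟮θ⟯) : ℂ) = _
  rw [h2]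
  exact congrArg (· ^ (i : ℕ)) h3

/-! ### Squarefreeness implies monogenicity. -/

theorem derivative_mem_of_mem_sq {R : Type*} [CommRing R] {M : Ideal R[X]} {f : R[X]}
    (hf : f ∈ M ^ 2) : derivative f ∈ M := by
  rw [pow_two] at hf
  refine Submodule.mul_induction_on hf (fun a ha b hb => ?_) fun x y hx hy => ?_
  · rw [derivative_mul]
    exact M.add_mem (M.mul_mem_left _ hb) (M.mul_mem_right _ ha)
  · rw [derivative_add]
    exact M.add_mem hx hy

theorem natCast_dvd_of_intCast_mem {p : ℕ} [Fact p.Prime] {M : Ideal ℤ[X]} (hM : M ≠ ⊤)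
    (hp : (p : ℤ[X]) ∈ M) {n : ℤ} (hn : (n : ℤ[X]) ∈ M) : (p : ℤ) ∣ n := by
  by_contra h
  obtain ⟨u, v, huv⟩ := (Nat.prime_iff_prime_int.1 (Fact.out : p.Prime)).coprime_iff_not_dvd.2 h
  refine hM ((Ideal.eq_top_iff_one M).2 ?_)
  have : (1 : ℤ[X]) = u * p + v * n := by exact_mod_cast huv.symm
  rw [this]
  exact M.add_mem (M.mul_mem_left _ hp) (M.mul_mem_left _ hn)

/-- Such an `n` is `p k` with `k` invertible modulo `p`. As `p² ∈ M²`, having `n` in `M²` would put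
`p` there too. -/
theorem intCast_notMem_sq_of_squarefree {p : ℕ} [Fact p.Prime] {M : Ideal ℤ[X]} (hM : M ≠ ⊤)
    (hp : (p : ℤ[X]) ∈ M) {n : ℤ} (hn : Squarefree n) : (n : ℤ[X]) ∉ M ^ 2 := by
  intro h
  obtain ⟨k, rfl⟩ := natCast_dvd_of_intCast_mem hM hp (Ideal.pow_le_self two_ne_zero h)
  have hpp := Nat.prime_iff_prime_int.1 (Fact.out : p.Prime)
  have hk : ¬ (p : ℤ) ∣ k := fun hk => hpp.not_isUnit (hn _ (mul_dvd_mul_left _ hk))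
  obtain ⟨u, v, huv⟩ := hpp.coprime_iff_not_dvd.2 hk
  refine natCast_notMem_sq p M hM hp ?_
  have h1 : (1 : ℤ[X]) = u * p + v * k := by exact_mod_cast huv.symm
  have : (p : ℤ[X]) = u * (p * p) + v * ((p * k : ℤ) : ℤ[X]) := by
    push_cast
    linear_combination (p : ℤ[X]) * h1
  rw [this]
  refine Ideal.add_mem _ (Ideal.mul_mem_left _ _ ?_) (Ideal.mul_mem_left _ _ h)
  rw [pow_two]
  exact Ideal.mul_mem_mul hp hp

theorem mem_sq_of_mul_mem_sq {R : Type*} [CommRing R] {M : Ideal R} (hM : M.IsMaximal) {a s : R}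
    (ha : a ∈ M) (hs : s ∉ M) (h : a * s ∈ M ^ 2) : a ∈ M ^ 2 := by
  obtain ⟨r, i, hi, hr⟩ := hM.exists_inv hs
  have : a = r * (a * s) + a * i := by linear_combination -a * hr
  rw [this]
  refine Ideal.add_mem _ (Ideal.mul_mem_left _ _ h) ?_
  rw [pow_two]
  exact Ideal.mul_mem_mul ha hi

theorem jonesTrinomial_eq (N b : ℕ) :
    jonesTrinomial N b = X ^ N - (N : ℤ[X]) * ((N : ℤ[X]) - 1) ^ b * X - ((N : ℤ[X]) - 1) := by
  simp [jonesTrinomial]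

theorem natDegree_jonesTrinomial {N : ℕ} (hN : 2 ≤ N) (b : ℕ) :
    (jonesTrinomial N b).natDegree = N := by
  unfold jonesTrinomial
  compute_degree!
  all_goals omega

theorem monic_jonesTrinomial {N : ℕ} (hN : 2 ≤ N) (b : ℕ) : (jonesTrinomial N b).Monic := by
  unfold jonesTrinomial
  monicity!
  simp [show ¬ N ≤ 1 by omega, show 1 ≤ N by omega]

/-- The factor `X` lets `X ^ N` be eliminated through the trinomial, leaving a linear remainder.
This both limits the maximal ideals to be tested and computes the discriminant. -/
theorem X_mul_derivative_jonesTrinomial {N : ℕ} (hN : 2 ≤ N) (b : ℕ) :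
    X * derivative (jonesTrinomial N b) = (N : ℤ[X]) * jonesTrinomial N b +
      (N : ℤ[X]) * ((N : ℤ[X]) - 1) * (((N : ℤ[X]) - 1) ^ b * X + 1) := by
  obtain ⟨n, rfl⟩ : ∃ n, N = n + 1 := ⟨N - 1, by omega⟩
  have : derivative (jonesTrinomial (n + 1) b) =
      (n + 1 : ℤ[X]) * X ^ n - (n + 1 : ℤ[X]) * ((n + 1 : ℤ[X]) - 1) ^ b := by
    rw [jonesTrinomial, derivative_sub, derivative_sub, derivative_C, derivative_C_mul,
      derivative_X_pow, derivative_X]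
    simp
  rw [this, jonesTrinomial_eq]
  push_cast
  ring

/-- The shifted form of the trinomial at the rational point `-(N - 1) ^ (-b)`. -/
theorem exists_pow_mul_eq_sq_mul_add {R : Type*} [CommRing R] {N : ℕ} (hN : Even N) (b : ℕ)
    {c : R} (hc : c = (N : R) - 1) (x : R) :
    ∃ G : R, c ^ (b * N) * (x ^ N - (N : R) * c ^ b * x - c) =
      (c ^ b * x + 1) ^ 2 * G - (N : R) * ((c ^ (b * N) + 1) * (c ^ b * x + 1))
        + (c ^ (b * N) + 1) := by
  -- With `s = c^b x + 1`, this expands `c^(bN) x^N = (s - 1)^N` to second order. Because `N - c =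
  -- 1`, the constant and linear terms acquire the common factor `c^(bN) + 1`.
  obtain ⟨k, hk⟩ := powAddExpansion (-1 : R) (c ^ b * x + 1) N
  have h1 : Odd (N - 1) ∨ N = 0 := by
    rcases Nat.eq_zero_or_pos N with h | h
    · exact Or.inr h
    · exact Or.inl (Nat.Even.sub_odd h hN odd_one)
  have h2 : (N : R) * (-1) ^ (N - 1) = -N := by
    rcases h1 with h | rfl
    · rw [h.neg_one_pow]; ring
    · simp
  have h3 : -1 + (c ^ b * x + 1) = c ^ b * x := by ring
  rw [h3, h2, hN.neg_one_pow, mul_pow, ← pow_mul] at hk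
  exact ⟨k, by linear_combination hk - c ^ (b * N) * hc⟩

theorem two_eq_zero_of_neg_one_pow_mul_add_one {A : Type*} [CommRing A] {x : A} {b m : ℕ}
    (hm : Even m) (hx : x ^ m = -1) (h : (-1) ^ b * x + 1 = 0) : (2 : A) = 0 := by
  have h1 := congrArg (· ^ m) (eq_neg_of_add_eq_zero_left h)
  simp only [mul_pow] at h1
  rw [hx, ← pow_mul, mul_comm b m, pow_mul, hm.neg_one_pow, one_pow] at h1
  linear_combination -h1

section

variable {N b p : ℕ} [Fact p.Prime] {M : Ideal ℤ[X]}

theorem jonesTrinomial_notMem_sq_of_sub_one_mem (hN : 2 ≤ N) (hb : 1 ≤ b) (hM : M.IsMaximal)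
    (hp : (p : ℤ[X]) ∈ M) (hsq : Squarefree ((N : ℤ) - 1)) (hc : (N : ℤ[X]) - 1 ∈ M) :
    jonesTrinomial N b ∉ M ^ 2 := by
  intro hf
  have hcb : ((N : ℤ[X]) - 1) ^ b ∈ M := Ideal.pow_mem_of_mem _ hc b hb
  have hX : X ∈ M := by
    refine hM.isPrime.mem_of_pow_mem N ?_
    have : (X : ℤ[X]) ^ N = jonesTrinomial N b + (N : ℤ[X]) * X * ((N : ℤ[X]) - 1) ^ b
        + ((N : ℤ[X]) - 1) := by
      rw [jonesTrinomial_eq]; ring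
    rw [this]
    exact M.add_mem (M.add_mem (Ideal.pow_le_self two_ne_zero hf) (M.mul_mem_left _ hcb)) hc
  refine intCast_notMem_sq_of_squarefree hM.ne_top hp hsq ?_
  have : (((N : ℤ) - 1 : ℤ) : ℤ[X]) = X ^ N - (N : ℤ[X]) * (((N : ℤ[X]) - 1) ^ b * X)
      - jonesTrinomial N b := by
    rw [jonesTrinomial_eq]; push_cast; ring
  rw [this]
  refine Ideal.sub_mem _ (Ideal.sub_mem _ ?_ (Ideal.mul_mem_left _ _ ?_)) hf
  · exact Ideal.pow_le_pow_right hN (Ideal.pow_mem_pow hX N)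
  · rw [pow_two]
    exact Ideal.mul_mem_mul hcb hX

theorem jonesTrinomial_notMem_sq_of_linear_mem (hN : Even N) (hM : M.IsMaximal)
    (hp : (p : ℤ[X]) ∈ M) (hsq : Squarefree (delta N b))
    (hs : ((N : ℤ[X]) - 1) ^ b * X + 1 ∈ M) : jonesTrinomial N b ∉ M ^ 2 := by
  intro hf
  refine intCast_notMem_sq_of_squarefree hM.ne_top hp hsq ?_
  obtain ⟨G, hG⟩ := exists_pow_mul_eq_sq_mul_add hN b (c := (N : ℤ[X]) - 1) rfl X
  set s : ℤ[X] := ((N : ℤ[X]) - 1) ^ b * X + 1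
  have hδ : (delta N b : ℤ[X]) = ((N : ℤ[X]) - 1) ^ (b * N) + 1 := by simp [delta]
  have hs2 : s ^ 2 * G ∈ M ^ 2 := Ideal.mul_mem_right _ _ (Ideal.pow_mem_pow hs 2)
  have key : (delta N b : ℤ[X]) = ((N : ℤ[X]) - 1) ^ (b * N) * jonesTrinomial N b - s ^ 2 * G
      + (N : ℤ[X]) * ((delta N b : ℤ[X]) * s) := by
    rw [jonesTrinomial_eq, hδ]
    linear_combination -hG
  -- The identity `key` is used twice: first it gives `δ ∈ M`; then `δ s ∈ M²`, and the same
  -- identity gives `δ ∈ M²`.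
  have hmem : (delta N b : ℤ[X]) ∈ M := by
    rw [key]
    exact M.add_mem (Ideal.pow_le_self two_ne_zero
      (Ideal.sub_mem _ (Ideal.mul_mem_left _ _ hf) hs2))
      (M.mul_mem_left _ (M.mul_mem_left _ hs))
  rw [key]
  refine Ideal.add_mem _ (Ideal.sub_mem _ (Ideal.mul_mem_left _ _ hf) hs2)
    (Ideal.mul_mem_left _ _ ?_)
  rw [pow_two]
  exact Ideal.mul_mem_mul hmem hs

theorem jonesTrinomial_notMem_sq_of_natCast_mem (hN : N ≡ 2 [MOD 4]) (hM : M.IsMaximal)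
    (hp : (p : ℤ[X]) ∈ M) (hsq : Squarefree (N : ℤ)) (hNM : (N : ℤ[X]) ∈ M) :
    jonesTrinomial N b ∉ M ^ 2 := by
  intro hf
  have hN4 : N % 4 = 2 := hN
  have hfM := Ideal.pow_le_self two_ne_zero hf
  have hpN : p ∣ N := by
    have := natCast_dvd_of_intCast_mem (n := N) hM.ne_top hp (by simpa using hNM)
    exact_mod_cast this
  obtain ⟨m, hm⟩ := hpN
  -- Modulo `p`, with `N = p m`, the trinomial is `X^N + 1 = (X^m + 1)^p`.
  have hT : (X ^ m + 1 : ℤ[X]) ∈ M := by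
    refine hM.isPrime.mem_of_pow_mem p ?_
    obtain ⟨r, hr⟩ := exists_add_pow_prime_eq (Fact.out : p.Prime) (X ^ m : ℤ[X]) 1
    have : (X ^ m + 1 : ℤ[X]) ^ p = jonesTrinomial N b
        + (N : ℤ[X]) * (((N : ℤ[X]) - 1) ^ b * X + 1) + (p : ℤ[X]) * (X ^ m * r) := by
      rw [hr, jonesTrinomial_eq, ← pow_mul, mul_comm m p, ← hm]
      simp
      ring
    rw [this]
    exact M.add_mem (M.add_mem hfM (M.mul_mem_right _ hNM)) (M.mul_mem_right _ hp)
  have hqc : Ideal.Quotient.mk M ((N : ℤ[X]) - 1) = -1 := by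
    rw [map_sub, Ideal.Quotient.eq_zero_iff_mem.2 hNM]; simp
  have hqT : Ideal.Quotient.mk M X ^ m = -1 := by
    have := Ideal.Quotient.eq_zero_iff_mem.2 hT
    rw [map_add, map_pow, map_one] at this
    exact eq_neg_of_add_eq_zero_left this
  have hTT : (X ^ m + 1 : ℤ[X]) ^ 2 ∈ M ^ 2 := Ideal.pow_mem_pow hT 2
  have hpT : (p : ℤ[X]) * (X ^ m + 1) ∈ M ^ 2 := by
    rw [pow_two]; exact Ideal.mul_mem_mul hp hT
  refine intCast_notMem_sq_of_squarefree hM.ne_top hp hsq ?_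
  rw [Int.cast_natCast]
  rcases (Fact.out : p.Prime).eq_two_or_odd' with rfl | hodd
  · refine mem_sq_of_mul_mem_sq hM hNM (s := ((N : ℤ[X]) - 1) ^ b * X) ?_ ?_
    · intro h
      have h0 := Ideal.Quotient.eq_zero_iff_mem.2 h
      rw [map_mul, map_pow, hqc] at h0
      have hX0 : Ideal.Quotient.mk M X = 0 := by
        have := congrArg (fun z => (-1) ^ b * z) h0
        simpa [← mul_assoc, ← mul_pow] using this
      rw [hX0, zero_pow (by omega)] at hqT
      have := Ideal.Quotient.eq_zero_iff_mem (I := M) (a := (1 : ℤ[X])) |>.1 (by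
        rw [map_one]; linear_combination hqT)
      exact hM.ne_top ((Ideal.eq_top_iff_one M).2 this)
    -- For `p = 2` and `T = X^m + 1`, the expansion `X^N = T² - 2T + 1` leaves the integer `2 - N =
    -- -4j`, which lies in `M²` because `N ≡ 2 [MOD 4]`.
    · obtain ⟨j, hj⟩ : ∃ j, m = 2 * j + 1 := ⟨m / 2, by omega⟩
      have hNj : (N : ℤ[X]) = 4 * j + 2 := by
        rw [hm, hj]; push_cast; ring
      have hXN : (X : ℤ[X]) ^ N = (X ^ m) ^ 2 := by rw [← pow_mul, hm, mul_comm]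
      have : (N : ℤ[X]) * (((N : ℤ[X]) - 1) ^ b * X) = (X ^ m + 1 : ℤ[X]) ^ 2
          - ((2 : ℕ) : ℤ[X]) * (X ^ m + 1) - (j : ℤ[X]) * (((2 : ℕ) : ℤ[X]) * ((2 : ℕ) : ℤ[X]))
          - jonesTrinomial N b := by
        rw [jonesTrinomial_eq, hXN]
        push_cast
        linear_combination -hNj
      rw [this]
      refine Ideal.sub_mem _ (Ideal.sub_mem _ (Ideal.sub_mem _ hTT hpT)
        (Ideal.mul_mem_left _ _ ?_)) hf
      rw [pow_two]; exact Ideal.mul_mem_mul hp hp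
  · have hme : Even m := by
      have : Even (p * m) := by rw [← hm, Nat.even_iff]; omega
      exact (Nat.even_mul.1 this).resolve_left (Nat.not_even_iff_odd.2 hodd)
    refine mem_sq_of_mul_mem_sq hM hNM (s := ((N : ℤ[X]) - 1) ^ b * X + 1) ?_ ?_
    · intro h
      have h0 := Ideal.Quotient.eq_zero_iff_mem.2 h
      rw [map_add, map_mul, map_pow, hqc, map_one] at h0
      have h2 : ((2 : ℤ) : ℤ[X]) ∈ M := by
        refine Ideal.Quotient.eq_zero_iff_mem.1 ?_
        push_cast
        rw [map_ofNat]
        exact two_eq_zero_of_neg_one_pow_mul_add_one hme hqT h0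
      have := natCast_dvd_of_intCast_mem hM.ne_top hp h2
      have h3 : p ∣ 2 := by exact_mod_cast this
      rcases (Nat.dvd_prime Nat.prime_two).1 h3 with h | h
      · exact (Fact.out : p.Prime).one_lt.ne' h
      · rw [h] at hodd; exact absurd hodd (by decide)
    · obtain ⟨k, hk⟩ := powAddExpansion (-1 : ℤ[X]) (X ^ m + 1) p
      have hpe : Even (p - 1) := Nat.Odd.sub_odd hodd odd_one
      rw [hodd.neg_one_pow, hpe.neg_one_pow, mul_one, show -1 + (X ^ m + 1) = (X ^ m : ℤ[X]) by ring,
        ← pow_mul, mul_comm m p, ← hm] at hk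
      have : (N : ℤ[X]) * (((N : ℤ[X]) - 1) ^ b * X + 1) = (p : ℤ[X]) * (X ^ m + 1)
          + k * (X ^ m + 1) ^ 2 - jonesTrinomial N b := by
        rw [jonesTrinomial_eq, hk]; ring
      rw [this]
      exact Ideal.sub_mem _ (Ideal.add_mem _ hpT (Ideal.mul_mem_left _ _ hTT)) hf

end

theorem isMonogenic_jonesTrinomial {N b : ℕ} (hN : 2 ≤ N) (hmod : N ≡ 2 [MOD 4]) (hb : 1 ≤ b)
    (hirr : Irreducible ((jonesTrinomial N b).map (Int.castRingHom ℚ)))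
    (hsq : Squarefree ((N : ℤ) * ((N : ℤ) - 1))) (hδ : Squarefree (delta N b)) :
    IsMonogenic (jonesTrinomial N b) := by
  have hmon := monic_jonesTrinomial hN b
  have hirrZ := (hmon.irreducible_iff_irreducible_map_fraction_map (K := ℚ)).2 hirr
  have hev : Even N := by
    have : N % 4 = 2 := hmod
    exact Nat.even_iff.2 (by omega)
  refine isMonogenic_of_isIntegrallyClosed hmon hirr
    (isIntegrallyClosed_adjoinRoot hmon hirrZ fun p M hp hM hpM hf => ?_)
  have := Fact.mk hp
  have h : (N : ℤ[X]) * ((N : ℤ[X]) - 1) * (((N : ℤ[X]) - 1) ^ b * X + 1) ∈ M := by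
    have h1 := M.mul_mem_left X (derivative_mem_of_mem_sq hf)
    rw [X_mul_derivative_jonesTrinomial hN] at h1
    exact (M.add_mem_iff_right (M.mul_mem_left _ (Ideal.pow_le_self two_ne_zero hf))).1 h1
  rcases hM.isPrime.mem_or_mem h with h | h
  · rcases hM.isPrime.mem_or_mem h with h | h
    · exact jonesTrinomial_notMem_sq_of_natCast_mem hmod hM hpM hsq.of_mul_left h hf
    · exact jonesTrinomial_notMem_sq_of_sub_one_mem hN hb hM hpM hsq.of_mul_right h hf
  · exact jonesTrinomial_notMem_sq_of_linear_mem hev hM hpM hδ h hf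

/-! ### Monogenicity implies squarefreeness. -/

theorem IsMonogenic.exists_aeval_eq {f : ℤ[X]} (hf : IsMonogenic f) {θ : ℂ} (hθ : aeval θ f = 0)
    {α : ℂ} (hα : α ∈ ℚ⟮θ⟯) (hint : IsIntegral ℤ α) :
    ∃ g : ℤ[X], g.degree < f.natDegree ∧ aeval θ g = α := by
  obtain ⟨B, hB⟩ := hf.2.2 θ hθ
  have hint' : IsIntegral ℤ (⟨α, hα⟩ : ℚ⟮θ⟯) :=
    (isIntegral_algebraMap_iff (algebraMap ℚ⟮θ⟯ ℂ).injective).1 hint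
  let x : 𝓞 ℚ⟮θ⟯ := ⟨⟨α, hα⟩, hint'⟩
  refine ⟨∑ i : Fin f.natDegree, C (B.repr x i) * X ^ (i : ℕ), ?_, ?_⟩
  · exact degree_sum_fin_lt _
  · have h := congrArg (fun y : 𝓞 ℚ⟮θ⟯ => ((y : ℚ⟮θ⟯) : ℂ)) (B.sum_repr x)
    have hx : ((x : ℚ⟮θ⟯) : ℂ) = α := rfl
    simp only [hx] at h
    rw [← h, map_sum]
    change _ = (algebraMap ℚ⟮θ⟯ ℂ) (algebraMap (𝓞 ℚ⟮θ⟯) ℚ⟮θ⟯ _)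
    rw [map_sum, map_sum]
    refine Finset.sum_congr rfl fun i _ => ?_
    rw [zsmul_eq_mul, map_mul, aeval_C, map_pow, aeval_X, map_mul, map_intCast, map_mul,
      map_intCast]
    exact congrArg _ (hB i).symm

theorem isIntegral_of_sq_add_mul_add_eq_zero {R A : Type*} [CommRing R] [CommRing A] [Algebra R A]
    {x u w : A} (hu : IsIntegral R u) (hw : IsIntegral R w) (h : x ^ 2 + u * x + w = 0) :
    IsIntegral R x := by
  refine isIntegral_trans (A := integralClosure R A) x
    ⟨X ^ 2 + C (⟨u, hu⟩ : integralClosure R A) * X + C (⟨w, hw⟩ : integralClosure R A), ?_, ?_⟩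
  · nontriviality (integralClosure R A)
    monicity!
  · simp only [eval₂_add, eval₂_mul, eval₂_pow, eval₂_X, eval₂_C]
    exact h

/-- The obstruction to monogenicity coming from a relation `T² G + p T U + p² V ≡ 0` modulo `f`. -/
theorem IsMonogenic.dvd_of_sq_relation {f : ℤ[X]} (hf : IsMonogenic f) {p : ℕ} (hp : p ≠ 0)
    {T G U V : ℤ[X]} (hrel : f ∣ T ^ 2 * G + (p : ℤ[X]) * T * U + (p : ℤ[X]) ^ 2 * V)
    (hdeg : (T * G).degree < f.natDegree) : (p : ℤ[X]) ∣ T * G := by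
  have hf0 : f.degree ≠ 0 := fun h => by
    have := degree_pos_of_irreducible hf.2.1
    rw [hf.1.degree_map, h] at this
    exact lt_irrefl _ this
  obtain ⟨θ, hθ⟩ := IsAlgClosed.exists_aeval_eq_zero ℂ f hf0
  have hp' : (p : ℂ) ≠ 0 := Nat.cast_ne_zero.2 hp
  have hint : IsIntegral ℤ θ := ⟨f, hf.1, hθ⟩
  have hintg : ∀ g : ℤ[X], IsIntegral ℤ (aeval θ g) := fun g =>
    adjoin_le_integralClosure hint (aeval_mem_adjoin_singleton ℤ θ)
  have hmem : ∀ g : ℤ[X], aeval θ g ∈ ℚ⟮θ⟯ := fun g => by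
    rw [← aeval_map_algebraMap ℚ θ]
    exact IntermediateField.algebra_adjoin_le_adjoin ℚ {θ} (aeval_mem_adjoin_singleton ℚ θ)
  have h0 : aeval θ (T ^ 2 * G + (p : ℤ[X]) * T * U + (p : ℤ[X]) ^ 2 * V) = 0 := by
    obtain ⟨h, hh⟩ := hrel
    rw [hh, map_mul, hθ, zero_mul]
  simp only [map_add, map_mul, map_pow, map_natCast] at h0
  -- Multiplying the relation by `G / p²` shows that `α = T G / p`, evaluated at `θ`, satisfies `α²
  -- + U α + G V = 0`, so it is integral.
  obtain ⟨g, hg, hgα⟩ := hf.exists_aeval_eq hθ (α := aeval θ (T * G) / p)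
    (div_mem (hmem _) (natCast_mem ℚ⟮θ⟯ p)) (by
      refine isIntegral_of_sq_add_mul_add_eq_zero (hintg U) (hintg (G * V)) ?_
      rw [map_mul, map_mul]
      field_simp
      linear_combination (aeval θ G) * h0)
  have hdvd : f ∣ (p : ℤ[X]) * g - T * G := by
    refine dvd_of_aeval_eq_zero hf.1 hf.2.1 hθ ?_
    rw [map_sub, map_mul, hgα, map_natCast, mul_div_cancel₀ _ hp', sub_self]
  have hz : (p : ℤ[X]) * g - T * G = 0 := by
    refine eq_zero_of_dvd_of_degree_lt hdvd ?_
    rw [degree_eq_natDegree hf.1.ne_zero]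
    refine (degree_sub_le _ _).trans_lt (max_lt ?_ hdeg)
    rw [← C_eq_natCast, degree_C_mul (Nat.cast_ne_zero.2 hp)]
    exact hg
  exact ⟨g, (sub_eq_zero.1 hz).symm⟩

theorem Int.squarefree_of_forall_prime {n : ℤ} (h : ∀ p : ℕ, p.Prime → ¬ (p : ℤ) ^ 2 ∣ n) :
    Squarefree n := by
  rw [← Int.squarefree_natAbs, Nat.squarefree_iff_prime_squarefree]
  intro p hp hd
  refine h p hp ?_
  rw [pow_two, ← Int.dvd_natAbs]
  exact_mod_cast hd

theorem not_natCast_dvd_of_monic {p : ℕ} (hp : p.Prime) {h : ℤ[X]} (hh : h.Monic) :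
    ¬ (p : ℤ[X]) ∣ h := by
  intro hd
  rw [← C_eq_natCast, C_dvd_iff_dvd_coeff] at hd
  have := hd h.natDegree
  rw [hh.coeff_natDegree] at this
  exact (Nat.prime_iff_prime_int.1 hp).not_dvd_one (by simpa using this)

theorem degree_lt_of_mul_natDegree_le {T Q : ℤ[X]} {n : ℕ} (hT : 1 ≤ T.natDegree)
    (h : (T * Q).natDegree ≤ n) : Q.degree < n := by
  rcases eq_or_ne Q 0 with rfl | hQ
  · simp
  · have hT0 : T ≠ 0 := by rintro rfl; simp at hT
    rw [natDegree_mul hT0 hQ] at h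
    rw [degree_eq_natDegree hQ]
    exact_mod_cast (by omega : Q.natDegree < n)

section

variable {N b p : ℕ}

theorem not_sq_dvd_sub_one_of_isMonogenic (hN : 2 ≤ N) (hb : 1 ≤ b)
    (hf : IsMonogenic (jonesTrinomial N b)) (hp : p.Prime) : ¬ (p : ℤ) ^ 2 ∣ (N : ℤ) - 1 := by
  rintro ⟨k, hk⟩
  obtain ⟨n, rfl⟩ : ∃ n, N = n + 2 := ⟨N - 2, by omega⟩
  -- As `b ≥ 1`, one factor `N - 1` can be split off the coefficient of `X`; modulo `p²` the
  -- trinomial is `X^N = X² · X^(N-2)`.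
  obtain ⟨d, rfl⟩ : ∃ d, b = d + 1 := ⟨b - 1, by omega⟩
  have hk' : ((n + 2 : ℕ) : ℤ[X]) - 1 = (p : ℤ[X]) ^ 2 * (k : ℤ[X]) := by
    have := congrArg (fun z : ℤ => (z : ℤ[X])) hk
    push_cast at this
    push_cast
    exact this
  have := hf.dvd_of_sq_relation (T := X) (G := X ^ n) (U := 0)
    (V := -(((n + 2 : ℕ) : ℤ[X]) * (((n + 2 : ℕ) : ℤ[X]) - 1) ^ d * (k : ℤ[X]) * X + (k : ℤ[X])))
    hp.ne_zero ⟨1, by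
      rw [jonesTrinomial_eq]
      linear_combination
        ((((n + 2 : ℕ) : ℤ[X]) * (((n + 2 : ℕ) : ℤ[X]) - 1) ^ d) * X + 1) * hk'⟩ (by
      rw [natDegree_jonesTrinomial hN, ← pow_succ', degree_X_pow]
      exact_mod_cast (by omega : n + 1 < n + 2))
  exact not_natCast_dvd_of_monic hp (monic_X.mul (monic_X_pow n)) this

theorem not_sq_dvd_of_isMonogenic (hN : 2 ≤ N) (hmod : N ≡ 2 [MOD 4])
    (hf : IsMonogenic (jonesTrinomial N b)) (hp : p.Prime) : ¬ (p : ℤ) ^ 2 ∣ (N : ℤ) := by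
  intro hd
  have hN4 : N % 4 = 2 := hmod
  have hd' : p ^ 2 ∣ N := by exact_mod_cast hd
  have hodd : Odd p := by
    rcases hp.eq_two_or_odd' with rfl | h
    · omega
    · exact h
  obtain ⟨k, hk⟩ := hd'
  have hk' : (N : ℤ[X]) = (p : ℤ[X]) ^ 2 * (k : ℤ[X]) := by
    rw [hk]; push_cast; ring
  set m := p * k
  have hm : N = p * m := by rw [hk]; ring
  have hm0 : m ≠ 0 := by intro h; rw [h] at hm; omega
  have hmN : m < N := by
    rw [hm]
    exact lt_mul_left (Nat.pos_of_ne_zero hm0) hp.one_lt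
  -- With `T = X^m + 1` this is `X^N = (T - 1)^p = -1 + p T + T² K`. The quotient `T K` is monic,
  -- hence not divisible by `p`.
  obtain ⟨K, hK⟩ := powAddExpansion (-1 : ℤ[X]) (X ^ m + 1) p
  have hpe : Even (p - 1) := Nat.Odd.sub_odd hodd odd_one
  rw [hodd.neg_one_pow, hpe.neg_one_pow, mul_one, show -1 + (X ^ m + 1) = (X ^ m : ℤ[X]) by ring,
    ← pow_mul, mul_comm m p, ← hm] at hK
  have hTmon : (X ^ m + 1 : ℤ[X]).Monic := monic_X_pow_add_C 1 hm0
  have hTdeg : (X ^ m + 1 : ℤ[X]).natDegree = m := natDegree_X_pow_add_C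
  have hprod : (X ^ m + 1 : ℤ[X]) * ((X ^ m + 1) * K) = X ^ N - ((p : ℤ[X]) * X ^ m + ((p : ℤ[X]) - 1)) := by
    linear_combination -hK
  have hlow : ((p : ℤ[X]) * X ^ m + ((p : ℤ[X]) - 1)).degree < (N : WithBot ℕ) := by
    have : ((p : ℤ[X]) * X ^ m + ((p : ℤ[X]) - 1)) = C (p : ℤ) * X ^ m + C ((p : ℤ) - 1) := by simp
    rw [this]
    refine (degree_add_le _ _).trans_lt (max_lt ?_ ?_)
    · exact (degree_C_mul_X_pow_le _ _).trans_lt (by exact_mod_cast hmN)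
    · exact degree_C_le.trans_lt (by exact_mod_cast (by omega : 0 < N))
  have hmon : ((X ^ m + 1 : ℤ[X]) * K).Monic := by
    refine hTmon.of_mul_monic_left ?_
    rw [hprod]
    exact monic_X_pow_sub hlow
  have hdeg : ((X ^ m + 1 : ℤ[X]) * K).degree < (N : WithBot ℕ) := by
    refine degree_lt_of_mul_natDegree_le (T := X ^ m + 1) (by omega) ?_
    rw [hprod]
    refine natDegree_le_of_degree_le ((degree_sub_le _ _).trans (max_le ?_ hlow.le))
    exact degree_X_pow_le _
  refine not_natCast_dvd_of_monic hp hmon (hf.dvd_of_sq_relation (U := 1)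
    (V := -((k : ℤ[X]) * (((N : ℤ[X]) - 1) ^ b * X + 1))) hp.ne_zero ⟨1, ?_⟩ ?_)
  · rw [jonesTrinomial_eq]
    linear_combination -hK + (((N : ℤ[X]) - 1) ^ b * X + 1) * hk'
  · rw [natDegree_jonesTrinomial hN]
    exact hdeg

theorem not_sq_dvd_delta_of_isMonogenic (hN : 2 ≤ N) (hev : Even N)
    (hf : IsMonogenic (jonesTrinomial N b)) (hp : p.Prime) : ¬ (p : ℤ) ^ 2 ∣ delta N b := by
  rintro ⟨k, hk⟩
  have hpp := Nat.prime_iff_prime_int.1 hp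
  have hpP : Prime (p : ℤ[X]) := by simpa using prime_C_iff.2 hpp
  obtain ⟨G, hG⟩ := exists_pow_mul_eq_sq_mul_add hev b (c := (N : ℤ[X]) - 1) rfl X
  have hδ : ((N : ℤ[X]) - 1) ^ (b * N) + 1 = (p : ℤ[X]) ^ 2 * (k : ℤ[X]) := by
    have := congrArg (fun z : ℤ => (z : ℤ[X])) hk
    simpa [delta] using this
  rw [hδ, ← jonesTrinomial_eq] at hG
  have hs : (((N : ℤ[X]) - 1) ^ b * X + 1 : ℤ[X]) = C (((N : ℤ) - 1) ^ b) * X + C 1 := by simp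
  have hc0 : ((N : ℤ) - 1) ^ b ≠ 0 := pow_ne_zero _ (by omega)
  have hsdeg : (((N : ℤ[X]) - 1) ^ b * X + 1 : ℤ[X]).natDegree = 1 := by
    rw [hs]; exact natDegree_linear hc0
  have hrel : (((N : ℤ[X]) - 1) ^ b * X + 1) ^ 2 * G + (p : ℤ[X]) *
      (((N : ℤ[X]) - 1) ^ b * X + 1) * 0 + (p : ℤ[X]) ^ 2 *
      ((k : ℤ[X]) - (N : ℤ[X]) * (k : ℤ[X]) * (((N : ℤ[X]) - 1) ^ b * X + 1)) =
      jonesTrinomial N b * ((N : ℤ[X]) - 1) ^ (b * N) := by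
    linear_combination -hG
  have hdeg : ((((N : ℤ[X]) - 1) ^ b * X + 1) * G).degree < (N : WithBot ℕ) := by
    refine degree_lt_of_mul_natDegree_le (T := ((N : ℤ[X]) - 1) ^ b * X + 1) hsdeg.ge ?_
    have : (((N : ℤ[X]) - 1) ^ b * X + 1) * ((((N : ℤ[X]) - 1) ^ b * X + 1) * G) =
        C (((N : ℤ) - 1) ^ (b * N)) * jonesTrinomial N b +
        C ((N : ℤ) * (p ^ 2 * k)) * (C (((N : ℤ) - 1) ^ b) * X + C 1) - C (p ^ 2 * k) := by
      rw [← hs]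
      simp only [map_mul, map_pow, map_sub, map_natCast, map_one, eq_intCast]
      linear_combination -hG
    rw [this]
    refine (natDegree_sub_le _ _).trans (max_le ((natDegree_add_le _ _).trans (max_le ?_ ?_)) ?_)
    · exact (natDegree_C_mul_le _ _).trans (natDegree_jonesTrinomial hN b).le
    · exact (natDegree_C_mul_le _ _).trans (natDegree_linear_le.trans (by omega))
    · rw [natDegree_C]; omega
  have hd := hf.dvd_of_sq_relation hp.ne_zero ⟨_, hrel⟩
    (by rw [natDegree_jonesTrinomial hN]; exact hdeg)
  -- Here `s G` need not be monic. Instead `p` would divide `c^(bN) f` with `f` monic, hence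
  -- `c^(bN)`, although it divides `c^(bN) + 1`.
  have hd2 : (p : ℤ[X]) ∣ jonesTrinomial N b * ((N : ℤ[X]) - 1) ^ (b * N) := by
    rw [← hrel]
    refine dvd_add (dvd_add ?_ (by simp)) (Dvd.dvd.mul_right (dvd_pow_self _ two_ne_zero) _)
    rw [pow_two, mul_assoc]
    exact hd.mul_left _
  rcases hpP.dvd_or_dvd hd2 with h | h
  · exact not_natCast_dvd_of_monic hp hf.1 h
  · have h1 : (p : ℤ[X]) ∣ 1 := by
      have h2 : (p : ℤ[X]) ∣ ((N : ℤ[X]) - 1) ^ (b * N) + 1 := by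
        rw [hδ]; exact Dvd.dvd.mul_right (dvd_pow_self _ two_ne_zero) _
      exact (dvd_add_right h).1 h2
    exact hpP.not_dvd_one h1

end

theorem squarefree_of_isMonogenic {N b : ℕ} (hN : 2 ≤ N) (hmod : N ≡ 2 [MOD 4]) (hb : 1 ≤ b)
    (hf : IsMonogenic (jonesTrinomial N b)) :
    Squarefree ((N : ℤ) * ((N : ℤ) - 1)) ∧ Squarefree (delta N b) := by
  have hev : Even N := by
    have : N % 4 = 2 := hmod
    exact Nat.even_iff.2 (by omega)
  refine ⟨?_, Int.squarefree_of_forall_prime fun p hp =>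
    not_sq_dvd_delta_of_isMonogenic hN hev hf hp⟩
  have hcop : IsCoprime (N : ℤ) ((N : ℤ) - 1) := ⟨1, -1, by ring⟩
  exact squarefree_mul_iff.2 ⟨hcop.isRelPrime,
    Int.squarefree_of_forall_prime fun p hp => not_sq_dvd_of_isMonogenic hN hmod hf hp,
    Int.squarefree_of_forall_prime fun p hp => not_sq_dvd_sub_one_of_isMonogenic hN hb hf hp⟩

/-! ### Discriminants and non-isomorphic fields. -/

theorem PowerBasis.norm_algebraMap_sub_gen {K S : Type*} [Field K] [CommRing S] [Algebra K S]
    (pb : PowerBasis K S) (q : K) :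
    Algebra.norm K (algebraMap K S q - pb.gen) = (minpoly K pb.gen).eval q := by
  rw [← charpoly_leftMulMatrix, Algebra.norm_eq_matrix_det pb.basis, map_sub, Matrix.eval_charpoly,
    AlgHom.commutes]
  rfl

section

variable {f : ℤ[X]} {θ : ℂ}

theorem IsMonogenic.isIntegral (hf : IsMonogenic f) (hθ : aeval θ f = 0) : IsIntegral ℚ θ :=
  IsIntegral.tower_top (R := ℤ) ⟨f, hf.1, hθ⟩

theorem IsMonogenic.minpoly_eq (hf : IsMonogenic f) (hθ : aeval θ f = 0) :
    minpoly ℚ θ = f.map (Int.castRingHom ℚ) :=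
  (minpoly.eq_of_irreducible_of_monic hf.2.1 ((aeval_map_algebraMap ℚ θ f).trans hθ)
    (hf.1.map _)).symm

theorem IsMonogenic.finrank_eq (hf : IsMonogenic f) (hθ : aeval θ f = 0) :
    Module.finrank ℚ ℚ⟮θ⟯ = f.natDegree := by
  rw [IntermediateField.adjoin.finrank (hf.isIntegral hθ), hf.minpoly_eq hθ, hf.1.natDegree_map]

theorem IsMonogenic.numberField (hf : IsMonogenic f) (hθ : aeval θ f = 0) :
    NumberField ℚ⟮θ⟯ where
  to_charZero := inferInstance
  to_finiteDimensional := IntermediateField.adjoin.finiteDimensional (hf.isIntegral hθ)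

end

section

variable {K : Type*} [Field K] [NumberField K] {n : ℕ} {t : K}

/-- The power basis of a number field obtained from a power basis of its ring of integers. -/
noncomputable def powerBasisOfIntegralPowers (B : Module.Basis (Fin n) ℤ (𝓞 K))
    (hB : ∀ i : Fin n, (B i : K) = t ^ (i : ℕ)) : PowerBasis ℚ K where
  gen := t
  dim := n
  basis := B.localizationLocalization ℚ (nonZeroDivisors ℤ) K
  basis_eq_pow i := by
    rw [Module.Basis.localizationLocalization_apply]
    exact hB i

theorem discr_eq_discr_powerBasisOfIntegralPowers (B : Module.Basis (Fin n) ℤ (𝓞 K))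
    (hB : ∀ i : Fin n, (B i : K) = t ^ (i : ℕ)) :
    (NumberField.discr K : ℚ) = Algebra.discr ℚ (powerBasisOfIntegralPowers B hB).basis := by
  rw [← NumberField.discr_eq_discr _ B]
  exact (Algebra.discr_localizationLocalization ℤ (nonZeroDivisors ℤ) K B).symm

/-- The discriminant is, up to sign, the norm of `f'(t)`, obtained from `t f'(t) = N c (c^b t + 1)`.
The factor `N - 1` on the left is the absolute norm of `t`; the norm of `c^b t + 1` is `c^(bN)
f(-c^(-b)) = δ`. -/
theorem abs_discr_eq_of_jonesTrinomial {N b : ℕ} (hN : 2 ≤ N) (hev : Even N)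
    (hirr : Irreducible ((jonesTrinomial N b).map (Int.castRingHom ℚ)))
    (B : Module.Basis (Fin n) ℤ (𝓞 K)) (hB : ∀ i : Fin n, (B i : K) = t ^ (i : ℕ))
    (ht0 : aeval t (jonesTrinomial N b) = 0) :
    ((N : ℚ) - 1) * |(NumberField.discr K : ℚ)| =
      (N : ℚ) ^ N * ((N : ℚ) - 1) ^ N * (((N : ℚ) - 1) ^ (b * N) + 1) := by
  have hmon := monic_jonesTrinomial hN b
  have hmin : minpoly ℚ t = (jonesTrinomial N b).map (Int.castRingHom ℚ) :=
    (minpoly.eq_of_irreducible_of_monic hirr ((aeval_map_algebraMap ℚ t _).trans ht0)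
      (hmon.map _)).symm
  have hfin : Module.finrank ℚ K = N := by
    rw [(powerBasisOfIntegralPowers B hB).finrank, ← PowerBasis.natDegree_minpoly]
    change (minpoly ℚ t).natDegree = N
    rw [hmin, hmon.natDegree_map, natDegree_jonesTrinomial hN]
  have hdiscr : |(NumberField.discr K : ℚ)| =
      |Algebra.norm ℚ (aeval t (derivative (jonesTrinomial N b)))| := by
    rw [discr_eq_discr_powerBasisOfIntegralPowers B hB, Algebra.discr_powerBasis_eq_norm, abs_mul,
      abs_pow, abs_neg, abs_one, one_pow, one_mul]
    change |Algebra.norm ℚ (aeval t (derivative (minpoly ℚ t)))| = _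
    rw [hmin, Polynomial.derivative_map]
    exact congrArg (fun z => |Algebra.norm ℚ z|) (aeval_map_algebraMap ℚ _ _)
  rw [hdiscr]
  set c : ℚ := (N : ℚ) - 1 with hc
  have hc0 : 0 < c := by
    have : (2 : ℚ) ≤ N := by exact_mod_cast hN
    rw [hc]; linarith
  have hcb : c ^ b * (c ^ b)⁻¹ = 1 := mul_inv_cancel₀ (pow_pos hc0 b).ne'
  have hnorm : ∀ q : ℚ, Algebra.norm ℚ (algebraMap ℚ K q - t) = q ^ N - N * c ^ b * q - c := by
    intro q
    refine ((powerBasisOfIntegralPowers B hB).norm_algebraMap_sub_gen q).trans ?_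
    change (minpoly ℚ t).eval q = _
    rw [hmin, jonesTrinomial_eq]
    simp [hc]
  have ht : Algebra.norm ℚ t = -c := by
    have h := hnorm 0
    have h1 : Algebra.norm ℚ (-1 : K) = 1 := by
      have := Algebra.norm_algebraMap (S := K) (-1 : ℚ)
      rwa [hfin, hev.neg_one_pow, map_neg, map_one] at this
    rw [map_zero, zero_sub, ← neg_one_mul, map_mul, h1, one_mul, zero_pow (by omega)] at h
    linarith
  have hs : Algebra.norm ℚ (algebraMap ℚ K (c ^ b) * t + 1) = c ^ (b * N) + 1 := by
    have h : algebraMap ℚ K (c ^ b) * t + 1 =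
        algebraMap ℚ K (-c ^ b) * (algebraMap ℚ K (-(c ^ b)⁻¹) - t) := by
      rw [mul_sub, ← map_mul, neg_mul_neg, hcb, map_one, map_neg]
      ring
    obtain ⟨G, hG⟩ := exists_pow_mul_eq_sq_mul_add hev b hc (-(c ^ b)⁻¹)
    have hz : c ^ b * -(c ^ b)⁻¹ + 1 = 0 := by rw [mul_neg, hcb]; ring
    rw [hz] at hG
    rw [h, map_mul, hnorm, Algebra.norm_algebraMap, hfin, hev.neg_pow, ← pow_mul, hG]
    ring
  have hrel : t * aeval t (derivative (jonesTrinomial N b)) =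
      algebraMap ℚ K (N * c) * (algebraMap ℚ K (c ^ b) * t + 1) := by
    have h := congrArg (aeval t) (X_mul_derivative_jonesTrinomial hN b)
    simp only [map_mul, map_add, aeval_X, ht0, map_natCast, map_sub, map_one, map_pow] at h
    rw [h]
    simp [hc]
  have h := congrArg (fun z => |Algebra.norm ℚ z|) hrel
  simp only [map_mul, ht, hs, abs_mul, abs_neg, Algebra.norm_algebraMap, hfin] at h
  rw [abs_of_pos hc0, abs_of_pos (a := c ^ (b * N) + 1) (by positivity),
    abs_of_pos (a := c ^ N) (by positivity), abs_of_nonneg (a := (N : ℚ) ^ N) (by positivity)] at h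
  exact h

end

theorem abs_discr_jonesTrinomial {N b : ℕ} (hN : 2 ≤ N) (hev : Even N) {θ : ℂ}
    (hf : IsMonogenic (jonesTrinomial N b)) (hθ : aeval θ (jonesTrinomial N b) = 0)
    [NumberField ℚ⟮θ⟯] :
    ((N : ℚ) - 1) * |(NumberField.discr ℚ⟮θ⟯ : ℚ)| =
      (N : ℚ) ^ N * ((N : ℚ) - 1) ^ N * (((N : ℚ) - 1) ^ (b * N) + 1) := by
  obtain ⟨B, hB⟩ := hf.2.2 θ hθ
  refine abs_discr_eq_of_jonesTrinomial hN hev hf.2.1 B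
    (t := IntermediateField.AdjoinSimple.gen ℚ θ) (fun i => Subtype.ext (hB i)) ?_
  refine (algebraMap ℚ⟮θ⟯ ℂ).injective ?_
  rw [← aeval_algebraMap_apply, map_zero]
  exact hθ

theorem isEmpty_algEquiv_of_isMonogenic {N b₁ b₂ : ℕ} (hN : 3 ≤ N) (hev : Even N) (hb : b₁ ≠ b₂)
    (hf₁ : IsMonogenic (jonesTrinomial N b₁)) (hf₂ : IsMonogenic (jonesTrinomial N b₂))
    {α₁ α₂ : ℂ} (h₁ : aeval α₁ (jonesTrinomial N b₁) = 0)
    (h₂ : aeval α₂ (jonesTrinomial N b₂) = 0) : IsEmpty (ℚ⟮α₁⟯ ≃ₐ[ℚ] ℚ⟮α₂⟯) := by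
  refine ⟨fun e => hb ?_⟩
  have := hf₁.numberField h₁
  have := hf₂.numberField h₂
  have hd₁ := abs_discr_jonesTrinomial (by omega) hev hf₁ h₁
  have hd₂ := abs_discr_jonesTrinomial (by omega) hev hf₂ h₂
  rw [NumberField.discr_eq_discr_of_algEquiv _ e, hd₂] at hd₁
  have hN' : (3 : ℚ) ≤ N := by exact_mod_cast hN
  have hc : (1 : ℚ) < (N : ℚ) - 1 := by linarith
  have h := mul_left_cancel₀ (by positivity) hd₁
  have h' := pow_right_injective₀ (by linarith) hc.ne' (add_right_cancel h)
  exact (Nat.eq_of_mul_eq_mul_right (by omega) h').symm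

/-! ### Small norms and the class group of `ℤ[√(t² + 1)]`. -/

/-- If `a ≤ (t - 1) b` or `a ≥ (t + 1) b`, then `a²` differs from `(t² + 1) b²` by at least `2 t b²
> t`. -/
theorem abs_sub_mul_lt_of_abs_sq_sub_le {t a b : ℤ} (ht : 0 < t) (ha : 0 ≤ a) (hb : 0 < b)
    (h : |a ^ 2 - (t ^ 2 + 1) * b ^ 2| ≤ t) : |a - t * b| < b := by
  obtain ⟨h1, h2⟩ := abs_le.1 h
  have hb2 : 1 ≤ b ^ 2 := by nlinarith
  have htb : t ≤ t * b ^ 2 := by nlinarith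
  rw [abs_lt]
  constructor
  · by_contra hlt
    have hle : a ≤ (t - 1) * b := by linarith
    have := mul_self_le_mul_self ha hle
    nlinarith
  · by_contra hlt
    have hle : (t + 1) * b ≤ a := by linarith
    have := mul_self_le_mul_self (by positivity) hle
    nlinarith

/-- In `ℤ[√(t² + 1)]`, an element of norm at most `t` is an integer up to a unit. -/
theorem Zsqrtd.exists_associated_intCast {t : ℤ} (ht : 0 < t) (z : ℤ√(t ^ 2 + 1))
    (hz : |z.norm| ≤ t) : ∃ x : ℤ, Associated z (x : ℤ√(t ^ 2 + 1)) := by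
  induction hn : z.im.natAbs using Nat.strong_induction_on generalizing z with
  | _ n ih =>
    obtain ⟨x, y⟩ := z
    by_cases hy : y = 0
    · subst hy
      exact ⟨x, Associated.of_eq (by ext <;> simp)⟩
    have hxy : |(|x| ^ 2 - (t ^ 2 + 1) * |y| ^ 2)| ≤ t := by
      rw [sq_abs, sq_abs]
      rw [Zsqrtd.norm_def] at hz
      convert hz using 2
      ring
    have hlt := abs_sub_mul_lt_of_abs_sq_sub_le ht (abs_nonneg x) (abs_pos.2 hy) hxy
    -- The sign `s` matches the signs of `x` and `y`. Multiplying by the unit `-s t + √(t² + 1)`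
    -- replaces `y` by the smaller `x - s t y`.
    obtain ⟨s, hs, hlt'⟩ : ∃ s : ℤ, s ^ 2 = 1 ∧ |x - s * t * y| < |y| := by
      rcases abs_choice x with hx | hx <;> rcases abs_choice y with hy' | hy'
      · exact ⟨1, by norm_num, by rw [hx] at hlt; nth_rw 1 [hy'] at hlt; simpa using hlt⟩
      · exact ⟨-1, by norm_num, by
          rw [hx] at hlt; nth_rw 1 [hy'] at hlt
          convert hlt using 2; ring⟩
      · exact ⟨-1, by norm_num, by
          rw [hx] at hlt; nth_rw 1 [hy'] at hlt
          rw [← abs_neg]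
          convert hlt using 2; ring⟩
      · exact ⟨1, by norm_num, by
          rw [hx] at hlt; nth_rw 1 [hy'] at hlt
          rw [← abs_neg]
          convert hlt using 2; ring⟩
    have hunorm : Zsqrtd.norm (⟨-(s * t), 1⟩ : ℤ√(t ^ 2 + 1)) = -1 := by
      rw [Zsqrtd.norm_def]
      linear_combination t ^ 2 * hs
    have hu : IsUnit (⟨-(s * t), 1⟩ : ℤ√(t ^ 2 + 1)) :=
      Zsqrtd.norm_eq_one_iff.1 (by rw [hunorm]; rfl)
    obtain ⟨w, hw⟩ := ih ((⟨x, y⟩ : ℤ√(t ^ 2 + 1)) * ⟨-(s * t), 1⟩).im.natAbs (by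
      rw [← hn, Zsqrtd.im_mul, ← Nat.cast_lt (α := ℤ), Int.natCast_natAbs, Int.natCast_natAbs]
      exact (congrArg abs
        (show x * 1 + y * -(s * t) = x - s * t * y by ring)).trans_lt hlt') _ (by rw [Zsqrtd.norm_mul, hunorm, mul_neg_one, abs_neg]; exact hz) rfl
    exact ⟨w, (associated_mul_unit_right _ _ hu).trans hw⟩

/-- If `𝒪 ≅ ℤ[√(c ^ (2 k) + 1)]` is a Dedekind domain and `c` is odd, then the class group of `𝒪`
has an element of order `2 k`: the class of the ideal whose `2 k`-th power is generated by
`1 + √(c ^ (2 k) + 1)`. -/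
theorem exists_orderOf_classGroup_eq {R : Type*} [CommRing R] [IsDedekindDomain R] {c : ℤ} {k : ℕ}
    (hc : 1 < c) (hodd : Odd c) (hk : 0 < k) (e : ℤ√((c ^ k) ^ 2 + 1) ≃+* R) :
    ∃ g : ClassGroup R, orderOf g = 2 * k := by
  set t := c ^ k with ht
  have ht0 : 0 < t := by positivity
  set w : R := e ⟨1, 1⟩ with hw
  set w' : R := e ⟨1, -1⟩ with hw'
  have hnw : Zsqrtd.norm (⟨1, 1⟩ : ℤ√(t ^ 2 + 1)) = -c ^ (2 * k) := by
    rw [Zsqrtd.norm_def, ht]; ring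
  have hww : w * w' = -(c : R) ^ (2 * k) := by
    have h : (⟨1, 1⟩ * ⟨1, -1⟩ : ℤ√(t ^ 2 + 1)) = ((-c ^ (2 * k) : ℤ) : ℤ√(t ^ 2 + 1)) := by
      refine Zsqrtd.ext ?_ ?_
      · rw [Zsqrtd.re_intCast, Zsqrtd.re_mul, ht]; ring
      · rw [Zsqrtd.im_intCast, Zsqrtd.im_mul]; ring
    rw [hw, hw', ← map_mul, h, map_intCast]
    push_cast
    ring
  have hsum : w + w' = 2 := by
    have h : (⟨1, 1⟩ + ⟨1, -1⟩ : ℤ√(t ^ 2 + 1)) = ((2 : ℤ) : ℤ√(t ^ 2 + 1)) := by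
      ext <;> simp
    rw [hw, hw', ← map_add, h, map_intCast]
    norm_num
  have hcop : IsCoprime w w' := by
    obtain ⟨j, hj⟩ := hodd.pow (n := 2 * k)
    have hj' : (c : R) ^ (2 * k) = 2 * (j : R) + 1 := by
      exact_mod_cast congrArg (Int.cast (R := R)) hj
    exact ⟨-w' - j, -j, by linear_combination -hww + hj' - (j : R) * hsum⟩
  have hprod : Ideal.span {w} * Ideal.span {w'} = Ideal.span {(c : R)} ^ (2 * k) := by
    rw [Ideal.span_singleton_mul_span_singleton, hww, Ideal.span_singleton_neg,
      Ideal.span_singleton_pow]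
  let _ : GCDMonoid (Ideal R) := UniqueFactorizationMonoid.toGCDMonoid _
  obtain ⟨𝔞, h𝔞⟩ := exists_eq_pow_of_mul_eq_pow_of_coprime
    (Ideal.isCoprime_span_singleton_iff _ _ |>.2 hcop) hprod
  have hw0 : w ≠ 0 := by
    rw [hw, Ne, map_eq_zero_iff e e.injective]
    intro h
    simpa using congrArg Zsqrtd.im h
  have h𝔞0 : 𝔞 ≠ 0 := by
    rintro rfl
    rw [zero_pow (by omega)] at h𝔞
    exact hw0 (Ideal.span_singleton_eq_bot.1 h𝔞)
  let I : nonZeroDivisors (Ideal R) := ⟨𝔞, mem_nonZeroDivisors_of_ne_zero h𝔞0⟩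
  have hprin : ∀ m : ℕ, ClassGroup.mk0 I ^ m = 1 ↔ (𝔞 ^ m).IsPrincipal := fun m => by
    rw [← map_pow, ClassGroup.mk0_eq_one_iff]
    rfl
  refine ⟨ClassGroup.mk0 I, ?_⟩
  have hpow : ClassGroup.mk0 I ^ (2 * k) = 1 := (hprin _).2 ⟨w, h𝔞.symm⟩
  obtain ⟨j, hj⟩ := orderOf_dvd_of_pow_eq_one hpow
  set m := orderOf (ClassGroup.mk0 I)
  have hm0 : 0 < m := Nat.pos_of_ne_zero (by rintro h; rw [h] at hj; omega)
  by_contra hne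
  have hj2 : 2 ≤ j := by
    rcases j with _ | _ | j
    · omega
    · omega
    · omega
  -- A proper divisor of `2k` is at most `k`, so a generator of `𝔞 ^ m` has absolute norm `c^m ≤ t`,
  -- the range of the descent.
  have hmk : m ≤ k := by nlinarith
  obtain ⟨α, hα⟩ := (hprin m).1 (pow_orderOf_eq_one _)
  obtain ⟨z, rfl⟩ := e.surjective α
  have hassoc : Associated (z ^ j) (⟨1, 1⟩ : ℤ√(t ^ 2 + 1)) := by
    have h : Ideal.span {e z ^ j} = Ideal.span {w} := by
      rw [h𝔞, hj, pow_mul, hα, ← Ideal.span_singleton_pow]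
    have h2 := (Ideal.span_singleton_eq_span_singleton.1 h).map e.symm
    simpa [hw] using h2
  have hnormabs : |z.norm| = c ^ m := by
    obtain ⟨u, hu⟩ := hassoc
    have h := congrArg (fun v => |Zsqrtd.norm v|) hu
    have hu1 : |(u : ℤ√(t ^ 2 + 1)).norm| = 1 := by
      have := Zsqrtd.norm_eq_one_iff.2 u.isUnit
      rw [← Int.natCast_natAbs, this]; rfl
    have hpn : (z ^ j).norm = z.norm ^ j := map_pow Zsqrtd.normMonoidHom z j
    simp only [Zsqrtd.norm_mul, abs_mul, hu1, hnw, hpn, abs_neg, abs_pow, mul_one] at h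
    rw [abs_of_pos (by omega : (0 : ℤ) < c), hj, pow_mul] at h
    exact (pow_left_inj₀ (abs_nonneg _) (by positivity) (by omega)).1 h
  obtain ⟨x, hx⟩ := Zsqrtd.exists_associated_intCast ht0 z
    (hnormabs.le.trans (pow_le_pow_right₀ hc.le hmk))
  have hdvd : (x : ℤ√(t ^ 2 + 1)) ∣ ⟨1, 1⟩ :=
    (hx.symm.dvd.trans (dvd_pow_self z (by omega))).trans hassoc.dvd
  have hxunit : IsUnit x := isUnit_of_dvd_one (Zsqrtd.intCast_dvd x _ |>.1 hdvd).1
  have hzunit : IsUnit z := hx.symm.isUnit (hxunit.map (Int.castRingHom _))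
  have h1 : |z.norm| = 1 := by
    have := Zsqrtd.norm_eq_one_iff.2 hzunit
    rw [← Int.natCast_natAbs, this]; rfl
  rw [hnormabs] at h1
  exact (one_lt_pow₀ hc (by omega)).ne' h1

/-! ### The ring of integers of `ℚ(√d)` for `d ≡ 2 mod 4`. -/

theorem Rat.exists_intCast_of_squarefree_mul_sq {d : ℤ} (hd : Squarefree d) {r : ℚ} {n : ℤ}
    (h : (d : ℚ) * r ^ 2 = n) : ∃ m : ℤ, r = m := by
  have hden : (r.den : ℤ) * r.den ∣ d := by
    have hcop : IsCoprime ((r.den : ℤ) * r.den) (r.num ^ 2) := by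
      have : IsCoprime (r.den : ℤ) r.num := (Rat.isCoprime_num_den r).symm
      exact (this.pow_right).mul_left this.pow_right
    refine hcop.dvd_of_dvd_mul_right ⟨n, ?_⟩
    have hr : r * r.den = r.num := Rat.mul_den_eq_num r
    have : (d : ℚ) * (r.num : ℚ) ^ 2 = (r.den : ℚ) * r.den * n := by
      rw [← hr, ← h]; ring
    exact_mod_cast this
  have hunit := hd _ hden
  have h1 : r.den = 1 := by
    have := Int.isUnit_iff_natAbs_eq.1 hunit
    simpa using this
  exact ⟨r.num, (Rat.coe_int_num_of_den_eq_one h1).symm⟩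

section

variable {d : ℤ}

theorem sqrt_ne_ratCast (hd : 0 ≤ d) (hmod : d % 4 = 2) (q : ℚ) : Real.sqrt d ≠ q := by
  intro h
  have hsq : ((d : ℚ)) = q ^ 2 := by
    have : (d : ℝ) = (q : ℝ) ^ 2 := by rw [← h, Real.sq_sqrt (by exact_mod_cast hd)]
    exact_mod_cast this
  obtain ⟨m, rfl⟩ : ∃ m : ℤ, q = m := by
    refine Rat.exists_intCast_of_squarefree_mul_sq (d := 1) squarefree_one (n := d) ?_
    rw [hsq]; simp
  have hm : d = m ^ 2 := by exact_mod_cast hsq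
  rcases Int.even_or_odd' m with ⟨k, hk | hk⟩
  · have : d = 4 * k ^ 2 := by rw [hm, hk]; ring
    omega
  · have : d = 4 * (k ^ 2 + k) + 1 := by rw [hm, hk]; ring
    omega

theorem finrank_realQuadraticField (hd : 0 ≤ d) (hmod : d % 4 = 2) :
    Module.finrank ℚ (realQuadraticField d) = 2 := by
  have hint := isIntegral_sqrt_intCast d
  rw [IntermediateField.adjoin.finrank hint]
  refine le_antisymm ?_ ((minpoly.two_le_natDegree_iff hint).2 ?_)
  · have hdeg : (X ^ 2 - C (d : ℚ)).natDegree = 2 := natDegree_X_pow_sub_C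
    rw [← hdeg]
    refine natDegree_le_of_dvd (minpoly.dvd ℚ _ ?_) (X_pow_sub_C_ne_zero two_pos _)
    simp [Real.sq_sqrt (by exact_mod_cast hd : (0 : ℝ) ≤ d)]
  · rintro ⟨q, hq⟩
    exact sqrt_ne_ratCast hd hmod q (hq.symm.trans (by simp))

theorem exists_eq_add_mul_sqrt (hd : 0 ≤ d) (hmod : d % 4 = 2) {x : ℝ}
    (hx : x ∈ realQuadraticField d) : ∃ p q : ℚ, x = p + q * Real.sqrt d := by
  have hint := isIntegral_sqrt_intCast d
  have hdim : (IntermediateField.adjoin.powerBasis hint).dim = 2 :=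
    (PowerBasis.finrank _).symm.trans (finrank_realQuadraticField hd hmod)
  obtain ⟨g, hg, hgx⟩ := (IntermediateField.adjoin.powerBasis hint).exists_eq_aeval
    (⟨x, hx⟩ : realQuadraticField d)
  rw [hdim] at hg
  obtain ⟨a, b, rfl⟩ := exists_eq_X_add_C_of_natDegree_le_one (by omega : g.natDegree ≤ 1)
  refine ⟨b, a, ?_⟩
  have h := congrArg (algebraMap (realQuadraticField d) ℝ) hgx
  rw [← aeval_algebraMap_apply, IntermediateField.adjoin.powerBasis_gen] at h
  refine h.trans ?_
  rw [IntermediateField.AdjoinSimple.algebraMap_gen]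
  simp
  ring

/-- For squarefree `d ≡ 2 mod 4`, an integral element `p + q √d` has `p, q ∈ ℤ`. -/
theorem exists_intCast_of_isIntegral (hd : 0 ≤ d) (hmod : d % 4 = 2) (hsq : Squarefree d) {p q : ℚ}
    (hx : IsIntegral ℤ ((p : ℝ) + q * Real.sqrt d)) : ∃ m n : ℤ, p = m ∧ q = n := by
  set x : ℝ := (p : ℝ) + q * Real.sqrt d with hxdef
  have hsqrt : Real.sqrt d ^ 2 = d := Real.sq_sqrt (by exact_mod_cast hd)
  by_cases hq : q = 0
  · have hp : IsIntegral ℤ p := by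
      rw [hxdef, hq, Rat.cast_zero, zero_mul, add_zero] at hx
      exact (isIntegral_algebraMap_iff (algebraMap ℚ ℝ).injective).1 hx
    obtain ⟨m, hm⟩ := IsIntegrallyClosed.isIntegral_iff.1 hp
    exact ⟨m, 0, by simpa using hm.symm, by simpa using hq⟩
  have hxQ : IsIntegral ℚ x := hx.tower_top
  obtain ⟨E, hE⟩ : ∃ E : ℚ, E = p ^ 2 - d * q ^ 2 := ⟨_, rfl⟩
  set Q : ℚ[X] := X ^ 2 + C (-2 * p) * X + C E
  have hQmon : Q.Monic := by
    simp only [Q]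
    monicity!
  have hQdeg : Q.natDegree = 2 := by
    simp only [Q]
    compute_degree!
  have hQx : aeval x Q = 0 := by
    simp only [Q, map_add, map_mul, map_pow, aeval_X, aeval_C, eq_ratCast, hE]
    push_cast
    rw [hxdef]
    linear_combination (q : ℝ) ^ 2 * hsqrt
  have hdeg : 2 ≤ (minpoly ℚ x).natDegree := by
    refine (minpoly.two_le_natDegree_iff hxQ).2 ?_
    rintro ⟨r, hr⟩
    refine sqrt_ne_ratCast hd hmod ((r - p) / q) ?_
    have hr' : (r : ℝ) = p + q * Real.sqrt d := by simpa using hr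
    have hq' : (q : ℝ) ≠ 0 := by exact_mod_cast hq
    push_cast
    rw [hr']
    field_simp
    ring
  -- So the trace `2p` and norm `p² - d q²` are integers `A`, `B`. Then `D = 2q` is integral and `A²
  -- - d D² = 4B` forces `A` and `D` to be even.
  have hQmin : Q = (minpoly ℤ x).map (algebraMap ℤ ℚ) := by
    rw [← minpoly.isIntegrallyClosed_eq_field_fractions' ℚ hx]
    exact (eq_of_monic_of_dvd_of_natDegree_le (minpoly.monic hxQ) hQmon (minpoly.dvd ℚ x hQx)
      (by rw [hQdeg]; exact hdeg))
  obtain ⟨A, hA⟩ : ∃ A : ℤ, 2 * p = A := by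
    have h := congrArg (fun P => coeff P 1) hQmin
    simp only [coeff_map, Q] at h
    refine ⟨-(minpoly ℤ x).coeff 1, ?_⟩
    have h' : -2 * p = ((minpoly ℤ x).coeff 1 : ℚ) := by
      simpa [coeff_X, coeff_C, coeff_X_pow] using h
    push_cast
    linarith
  obtain ⟨B, hB⟩ : ∃ B : ℤ, p ^ 2 - d * q ^ 2 = B := by
    rw [← hE]
    have h := congrArg (fun P => coeff P 0) hQmin
    simp only [coeff_map, Q] at h
    exact ⟨(minpoly ℤ x).coeff 0, by simpa [coeff_X, coeff_C, coeff_X_pow] using h⟩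
  obtain ⟨D, hD⟩ := Rat.exists_intCast_of_squarefree_mul_sq hsq (r := 2 * q) (n := A ^ 2 - 4 * B) (by
    push_cast
    rw [← hA, ← hB]
    ring)
  have hrel : A ^ 2 - d * D ^ 2 = 4 * B := by
    have : (A : ℚ) ^ 2 - d * (D : ℚ) ^ 2 = 4 * B := by
      rw [← hA, ← hD, ← hB]; ring
    exact_mod_cast this
  obtain ⟨j, hj⟩ : ∃ j, d = 4 * j + 2 := ⟨d / 4, by omega⟩
  rw [hj] at hrel
  obtain ⟨a, ha | ha⟩ := Int.even_or_odd' A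
  · obtain ⟨r, hr | hr⟩ := Int.even_or_odd' D
    · refine ⟨a, r, ?_, ?_⟩
      · rw [ha] at hA; push_cast at hA; linarith
      · rw [hr] at hD; push_cast at hD; linarith
    · exfalso
      rw [ha, hr] at hrel
      ring_nf at hrel
      omega
  · exfalso
    rw [ha] at hrel
    ring_nf at hrel
    omega

/-- For squarefree `d ≡ 2 mod 4`, the ring of integers of `ℚ(√d)` is `ℤ[√d]`. -/
theorem nonempty_ringEquiv_ringOfIntegers (hd : 0 ≤ d) (hmod : d % 4 = 2) (hsq : Squarefree d) :
    Nonempty (ℤ√d ≃+* 𝓞 (realQuadraticField d)) := by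
  have hsqrt : Real.sqrt d * Real.sqrt d = d := Real.mul_self_sqrt (by exact_mod_cast hd)
  have hint : IsIntegral ℤ (IntermediateField.AdjoinSimple.gen ℚ (Real.sqrt d)) := by
    refine IsIntegral.of_pow (n := 2) two_pos ?_
    have : IntermediateField.AdjoinSimple.gen ℚ (Real.sqrt d) ^ 2 =
        algebraMap ℤ (realQuadraticField d) d := Subtype.ext (by
      rw [pow_two]
      exact hsqrt.trans (by simp))
    rw [this]
    exact isIntegral_algebraMap
  let r : 𝓞 (realQuadraticField d) := ⟨_, hint⟩
  have hr : r * r = (d : 𝓞 (realQuadraticField d)) := by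
    refine NumberField.RingOfIntegers.ext (Subtype.ext ?_)
    exact hsqrt.trans (by simp)
  have hcoe : ∀ z : ℤ√d, ((Zsqrtd.lift ⟨r, hr⟩ z : realQuadraticField d) : ℝ) =
      z.re + z.im * Real.sqrt d := fun z => by
    have hr' : ((r : realQuadraticField d) : ℝ) = Real.sqrt d := rfl
    rw [← hr']
    simp [Zsqrtd.lift]
  refine ⟨RingEquiv.ofBijective (Zsqrtd.lift ⟨r, hr⟩) ⟨Zsqrtd.lift_injective _ fun n hn => ?_, ?_⟩⟩
  · refine sqrt_ne_ratCast hd hmod (|n| : ℤ) ?_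
    rw [hn]
    push_cast
    rw [Real.sqrt_mul_self_eq_abs]
  · intro y
    obtain ⟨p, q, hpq⟩ := exists_eq_add_mul_sqrt hd hmod (y : realQuadraticField d).2
    have hy : IsIntegral ℤ ((p : ℝ) + q * Real.sqrt d) := by
      rw [← hpq]
      exact (NumberField.RingOfIntegers.isIntegral_coe y).map
        ((algebraMap (realQuadraticField d) ℝ).toIntAlgHom)
    obtain ⟨m, n, rfl, rfl⟩ := exists_intCast_of_isIntegral hd hmod hsq hy
    refine ⟨⟨m, n⟩, NumberField.RingOfIntegers.ext (Subtype.ext ?_)⟩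
    rw [hcoe, hpq]
    simp

end

/-! ### The class number and the main theorem. -/

theorem dvd_classNumber_realQuadraticField {c : ℤ} {k : ℕ} (hc : 1 < c) (hodd : Odd c) (hk : 0 < k)
    (hsq : Squarefree ((c ^ k) ^ 2 + 1)) :
    Module.finrank ℚ (realQuadraticField ((c ^ k) ^ 2 + 1)) = 2 ∧
      k ∣ NumberField.classNumber (realQuadraticField ((c ^ k) ^ 2 + 1)) := by
  have hd : (0 : ℤ) ≤ (c ^ k) ^ 2 + 1 := by positivity
  have hmod : ((c ^ k) ^ 2 + 1) % 4 = 2 := by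
    obtain ⟨j, hj⟩ := hodd.pow (n := k)
    have : (c ^ k) ^ 2 + 1 = 4 * (j ^ 2 + j) + 2 := by rw [hj]; ring
    omega
  refine ⟨finrank_realQuadraticField hd hmod, ?_⟩
  obtain ⟨e⟩ := nonempty_ringEquiv_ringOfIntegers hd hmod hsq
  obtain ⟨g, hg⟩ := exists_orderOf_classGroup_eq hc hodd hk e
  exact (Dvd.intro_left 2 hg.symm).trans orderOf_dvd_card

theorem mainTheorem3 (N : ℕ) (hN : 6 ≤ N) (hmod : N ≡ 2 [MOD 4]) :
    -- characterization of monogenicity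
    (∀ b : ℕ, 1 ≤ b → Irreducible ((jonesTrinomial N b).map (Int.castRingHom ℚ)) →
      (IsMonogenic (jonesTrinomial N b) ↔
        Squarefree ((N : ℤ) * ((N : ℤ) - 1)) ∧ Squarefree (delta N b))) ∧
    -- the fields generated by roots of the monogenic trinomials have degree `N` ...
    (∀ b : ℕ, 1 ≤ b → IsMonogenic (jonesTrinomial N b) →
      ∀ α : ℂ, aeval α (jonesTrinomial N b) = 0 → Module.finrank ℚ ℚ⟮α⟯ = N) ∧
    -- ... and are pairwise distinct, even up to isomorphism
    (∀ b₁ b₂ : ℕ, 1 ≤ b₁ → 1 ≤ b₂ → b₁ ≠ b₂ →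
      IsMonogenic (jonesTrinomial N b₁) → IsMonogenic (jonesTrinomial N b₂) →
      ∀ α₁ α₂ : ℂ, aeval α₁ (jonesTrinomial N b₁) = 0 → aeval α₂ (jonesTrinomial N b₂) = 0 →
        IsEmpty (ℚ⟮α₁⟯ ≃ₐ[ℚ] ℚ⟮α₂⟯)) ∧
    -- divisibility of the class number (`N` is even, so the division `b * N / 2` is exact)
    (∀ b : ℕ, 1 ≤ b → IsMonogenic (jonesTrinomial N b) →
      Module.finrank ℚ (realQuadraticField (delta N b)) = 2 ∧
      b * N / 2 ∣ NumberField.classNumber (realQuadraticField (delta N b))) := by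
  have hN4 : N % 4 = 2 := hmod
  have hev : Even N := Nat.even_iff.2 (by omega)
  have hN2 : 2 ≤ N := by omega
  refine ⟨fun b hb hirr => ⟨squarefree_of_isMonogenic hN2 hmod hb,
      fun h => isMonogenic_jonesTrinomial hN2 hmod hb hirr h.1 h.2⟩,
    fun b _ hf α hα => (hf.finrank_eq hα).trans (natDegree_jonesTrinomial hN2 b),
    fun b₁ b₂ _ _ hne hf₁ hf₂ α₁ α₂ h₁ h₂ =>
      isEmpty_algEquiv_of_isMonogenic (by omega) hev hne hf₁ hf₂ h₁ h₂,
    fun b hb hf => ?_⟩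
  obtain ⟨m, hm⟩ := hev
  have hk : b * N / 2 = b * m := by
    rw [hm, ← two_mul, mul_left_comm, Nat.mul_div_cancel_left _ two_pos]
  have hδ : delta N b = (((N : ℤ) - 1) ^ (b * m)) ^ 2 + 1 := by
    rw [delta, ← pow_mul, hm]
    congr 2
    ring
  have hsq := (squarefree_of_isMonogenic hN2 hmod hb hf).2
  rw [hδ] at hsq
  rw [hk, hδ]
  exact dvd_classNumber_realQuadraticField (by omega) ⟨m - 1, by omega⟩
    (Nat.mul_pos hb (by omega)) hsq
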